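/- Let $D_B(\rho,\sigma)=\sqrt{2\bigl(1-\|\sqrt\rho\sqrt\sigma\|_1\bigr)}$ be the Bures distance of two quantum states (density matrices) on $\mathbb{C}^d$. Let $\chi^2_{\mathrm{Bures}}(\rho,\sigma)\in[0,\infty]$ be the Bures $\chi^2$-divergence, defined by $$\chi^2_{\mathrm{Bures}}(\rho,\sigma)=\sum_{i,j=1}^d \frac{2}{q_i+q_j}\,\bigl|\langle u_i|(\rho-\sigma)|u_j\rangle\bigr|^2 ,$$ where $(u_i)$ is an orthonormal eigenbasis of $\sigma$ with eigenvalues $(q_i)$, and $0/0=0$, $x/0=\infty$ for $x>0$. There is a universal constant $C>0$ such that the following holds. Let $d\ge 1$, let $\sigma$ be a quantum state on $\mathbb{C}^d$, let $\theta>0$, and let $T$ be an integer with $T\ge C\,d/\theta$. Then there is an algorithm (a two-outcome measurement, accept/reject, on $(\mathbb{C}^d)^{\otimes T}$, depending only on $d,\sigma,\theta,T$) that, for all quantum states $\rho_1,\dots,\rho_T$ on $\mathbb{C}^d$ with average $\rho_{\mathrm{avg}}=\frac1T\sum_{t=1}^T\rho_t$, when applied to one copy of each, i.e. to $\rho_1\otimes\cdots\otimes\rho_T$,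 - accepts with probability at least $.99$ if $\chi^2_{\mathrm{Bures}}(\rho_{\mathrm{avg}},\sigma)\le .99\,\theta$, and - rejects with probability at least $.99$ if $D_B(\rho_{\mathrm{avg}},\sigma)^2>1.01\,\theta$. In particular, $C$ does not depend on the minimum eigenvalue of $\sigma$. -/

import Mathlib

noncomputable section

namespace QuantumTesting

open scoped ENNReal ComplexOrder

/-- A quantum state (density matrix) on the Hilbert space `ℂ^n`: positive semidefinite, trace one. -/
structure IsState {n : Type*} [Fintype n] (ρ : Matrix n n ℂ) : Prop where
  posSemidef : ρ.PosSemidef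
  trace_eq_one : ρ.trace = 1

/-- The average state `ρ_avg = (1 / T) ∑ₜ ρₜ`. -/
def avgState {d T : ℕ} (ρ : Fin T → Matrix (Fin d) (Fin d) ℂ) : Matrix (Fin d) (Fin d) ℂ :=
  (T : ℂ)⁻¹ • ∑ t, ρ t

/-- The product state `ρ₁ ⊗ ⋯ ⊗ ρ_T` on `(ℂ^d)^{⊗ T}`, as a matrix in the product basis, which is
indexed by the functions `Fin T → Fin d`. -/
def productState {d T : ℕ} (ρ : Fin T → Matrix (Fin d) (Fin d) ℂ) :
    Matrix (Fin T → Fin d) (Fin T → Fin d) ℂ :=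
  Matrix.of fun i j => ∏ t, ρ t (i t) (j t)

/-- A two-outcome quantum measurement (POVM) `{E, 1 - E}` on `ℂ^n`; the outcome of `E` is "accept",
that of `1 - E` is "reject". Every quantum algorithm with one bit of output (including one that uses
randomness, ancillas, collective or adaptive measurements and post-processing) induces exactly
such a pair on its input register. -/
structure Test (n : Type*) [Fintype n] [DecidableEq n] where
  effect : Matrix n n ℂ
  effect_posSemidef : effect.PosSemidef
  compl_posSemidef : (1 - effect).PosSemidef

/-- The probability (Born rule) that the test accepts the state `ϱ`. -/
def Test.acceptProb {n : Type*} [Fintype n] [DecidableEq n] (A : Test n) (ϱ : Matrix n n ℂ) : ℝ :=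
  (ϱ * A.effect).trace.re

/-- The probability (Born rule) that the test rejects the state `ϱ`. -/
def Test.rejectProb {n : Type*} [Fintype n] [DecidableEq n] (A : Test n) (ϱ : Matrix n n ℂ) : ℝ :=
  (ϱ * (1 - A.effect)).trace.re

open scoped MatrixOrder in
/-- The Schatten 1-norm `‖A‖₁ = Tr √(A† A)`. -/
def traceNorm {n : Type*} [Fintype n] [DecidableEq n] (A : Matrix n n ℂ) : ℝ :=
  (CFC.abs A).trace.re

open scoped MatrixOrder in
/-- The fidelity `F(ρ, σ) = ‖√ρ √σ‖₁²`. -/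
def fidelity {n : Type*} [Fintype n] [DecidableEq n] (ρ σ : Matrix n n ℂ) : ℝ :=
  traceNorm (CFC.sqrt ρ * CFC.sqrt σ) ^ 2

/-- The Bures distance `D_B(ρ, σ) = √(2 (1 - √F(ρ, σ)))`. -/
def buresDist {n : Type*} [Fintype n] [DecidableEq n] (ρ σ : Matrix n n ℂ) : ℝ :=
  √(2 * (1 - √(fidelity ρ σ)))

/-- The expression `∑ i j, 2 / (q i + q j) * |Δ i j|²` for nonnegative `q`, with values in `[0, ∞]`.
Division in `ℝ≥0∞` follows the conventions `0 / 0 = 0` and `x / 0 = ∞` for `x > 0`. -/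
def diagChiSq {n : Type*} [Fintype n] (q : n → ℝ) (Δ : Matrix n n ℂ) : ℝ≥0∞ :=
  ∑ i, ∑ j, ENNReal.ofReal (2 * ‖Δ i j‖ ^ 2) / ENNReal.ofReal (q i + q j)

/-- The Bures `χ²`-divergence of `ρ` from the state `σ`: with `σ = U diag(q) U†` an
eigendecomposition, it is `∑ i j, 2 / (q i + q j) * |(U† (ρ - σ) U) i j|²`, valued in `[0, ∞]`.
By `buresChiSq_eq` below any eigendecomposition gives the same value. -/
def buresChiSq {n : Type*} [Fintype n] [DecidableEq n] (ρ : Matrix n n ℂ) {σ : Matrix n n ℂ}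
    (hσ : IsState σ) : ℝ≥0∞ :=
  let U : Matrix n n ℂ := hσ.posSemidef.isHermitian.eigenvectorUnitary
  diagChiSq hσ.posSemidef.isHermitian.eigenvalues (star U * (ρ - σ) * U)

/-- Weighted squared entries, with weights depending on the eigenvalues only, do not depend on the
choice of the eigenbasis. -/
theorem sum_weight_normSq_conj {n : Type*} [Fintype n] [DecidableEq n] (p q : n → ℝ)
    (X W : Matrix n n ℂ) (hW : W * star W = 1) (hpq : ∀ k i, W k i ≠ 0 → p k = q i)
    (g : ℝ → ℝ) :
    ∑ i, ∑ j, g (q i + q j) * ‖(star W * X * W) i j‖ ^ 2 =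
      ∑ i, ∑ j, g (p i + p j) * ‖X i j‖ ^ 2 := by
  have key : ∀ (r : n → ℝ) (Y : Matrix n n ℂ),
      (((∑ i, ∑ j, g (r i + r j) * ‖Y i j‖ ^ 2 : ℝ)) : ℂ) =
        (star Y * Matrix.of fun i j => (g (r i + r j) : ℂ) * Y i j).trace := by
    intro r Y
    simp only [Matrix.trace, Matrix.diag, Matrix.mul_apply, Matrix.star_apply, Matrix.of_apply]
    rw [Finset.sum_comm]
    push_cast
    refine Finset.sum_congr rfl fun i _ => Finset.sum_congr rfl fun j _ => ?_
    rw [← Complex.conj_mul']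
    simp only [RCLike.star_def]
    ring
  have hconj : (Matrix.of fun i j => (g (q i + q j) : ℂ) * (star W * X * W) i j) =
      star W * (Matrix.of fun i j => (g (p i + p j) : ℂ) * X i j) * W := by
    ext i j
    simp only [Matrix.of_apply, Matrix.mul_apply, Finset.mul_sum, Finset.sum_mul]
    refine Finset.sum_congr rfl fun l _ => Finset.sum_congr rfl fun k _ => ?_
    by_cases h1 : W k i = 0
    · simp [Matrix.star_apply, h1]
    by_cases h2 : W l j = 0
    · simp [h2]
    rw [hpq k i h1, hpq l j h2]
    ring
  have h : (((∑ i, ∑ j, g (q i + q j) * ‖(star W * X * W) i j‖ ^ 2 : ℝ)) : ℂ) =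
      ((∑ i, ∑ j, g (p i + p j) * ‖X i j‖ ^ 2 : ℝ) : ℂ) := by
    rw [key, key, hconj]
    set Z := (Matrix.of fun i j => (g (p i + p j) : ℂ) * X i j)
    calc (star (star W * X * W) * (star W * Z * W)).trace
        = (star W * (star X * (W * star W) * Z * W)).trace := by
          simp only [star_mul, star_star, mul_assoc]
      _ = (star X * Z).trace := by
          rw [Matrix.trace_mul_comm, hW, mul_one, mul_assoc, hW, mul_one]
  exact_mod_cast h

/-- `diagChiSq` as a finite part plus `∞` times the weight of the entries with denominator zero. -/
theorem diagChiSq_eq_add {n : Type*} [Fintype n] (q : n → ℝ) (Δ : Matrix n n ℂ) :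
    diagChiSq q Δ =
      ENNReal.ofReal (∑ i, ∑ j, (if 0 < q i + q j then 2 * (q i + q j)⁻¹ else 0) * ‖Δ i j‖ ^ 2) +
      ⊤ * ENNReal.ofReal (∑ i, ∑ j, (if 0 < q i + q j then 0 else 1) * ‖Δ i j‖ ^ 2) := by
  have h1 : ∀ i j, 0 ≤ (if 0 < q i + q j then 2 * (q i + q j)⁻¹ else 0) * ‖Δ i j‖ ^ 2 := by
    intro i j
    split_ifs <;> positivity
  have h2 : ∀ i j, 0 ≤ (if 0 < q i + q j then (0 : ℝ) else 1) * ‖Δ i j‖ ^ 2 := by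
    intro i j
    split_ifs <;> positivity
  rw [ENNReal.ofReal_sum_of_nonneg fun i _ => Finset.sum_nonneg fun j _ => h1 i j,
    ENNReal.ofReal_sum_of_nonneg fun i _ => Finset.sum_nonneg fun j _ => h2 i j,
    Finset.mul_sum, ← Finset.sum_add_distrib, diagChiSq]
  refine Finset.sum_congr rfl fun i _ => ?_
  rw [ENNReal.ofReal_sum_of_nonneg fun j _ => h1 i j,
    ENNReal.ofReal_sum_of_nonneg fun j _ => h2 i j, Finset.mul_sum, ← Finset.sum_add_distrib]
  refine Finset.sum_congr rfl fun j _ => ?_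
  by_cases h : 0 < q i + q j
  · simp only [h, if_true, zero_mul, ENNReal.ofReal_zero, mul_zero, add_zero]
    rw [← ENNReal.ofReal_div_of_pos h]
    congr 1
    field_simp
  · simp only [h, if_false, zero_mul, ENNReal.ofReal_zero, zero_add, one_mul]
    rw [ENNReal.ofReal_eq_zero.2 (not_lt.1 h)]
    by_cases hz : ‖Δ i j‖ = 0
    · simp [hz]
    · have hp : 0 < ‖Δ i j‖ ^ 2 := by positivity
      rw [ENNReal.div_zero (by simpa using hz), ENNReal.top_mul (by simpa using hz)]

/-- The Bures `χ²`-divergence may be computed in any eigenbasis of `σ`. -/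
theorem buresChiSq_eq {n : Type*} [Fintype n] [DecidableEq n] (ρ : Matrix n n ℂ)
    {σ : Matrix n n ℂ} (hσ : IsState σ) (q : n → ℝ) (V : Matrix n n ℂ)
    (hV : V ∈ Matrix.unitaryGroup n ℂ)
    (h : σ = V * Matrix.diagonal (fun i => (q i : ℂ)) * star V) :
    buresChiSq ρ hσ = diagChiSq q (star V * (ρ - σ) * V) := by
  set U : Matrix n n ℂ := hσ.posSemidef.isHermitian.eigenvectorUnitary.1 with hU
  set p := hσ.posSemidef.isHermitian.eigenvalues with hp
  have hUU : U * star U = 1 :=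
    Matrix.mem_unitaryGroup_iff.1 hσ.posSemidef.isHermitian.eigenvectorUnitary.2
  have hUU' : star U * U = 1 :=
    Matrix.mem_unitaryGroup_iff'.1 hσ.posSemidef.isHermitian.eigenvectorUnitary.2
  have hVV : V * star V = 1 := Matrix.mem_unitaryGroup_iff.1 hV
  have hVV' : star V * V = 1 := Matrix.mem_unitaryGroup_iff'.1 hV
  have hsp : σ = U * Matrix.diagonal (fun i => (p i : ℂ)) * star U := by
    have := hσ.posSemidef.isHermitian.spectral_theorem
    rw [Unitary.conjStarAlgAut_apply] at this
    exact this
  have hW : (star U * V) * star (star U * V) = 1 := by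
    rw [star_mul, star_star]
    calc star U * V * (star V * U) = star U * (V * star V) * U := by simp only [mul_assoc]
      _ = 1 := by rw [hVV, mul_one, hUU']
  have hint : Matrix.diagonal (fun i => (p i : ℂ)) * (star U * V) =
      (star U * V) * Matrix.diagonal (fun i => (q i : ℂ)) := by
    calc Matrix.diagonal (fun i => (p i : ℂ)) * (star U * V)
        = (star U * U) * Matrix.diagonal (fun i => (p i : ℂ)) * star U * V := by
          rw [hUU', one_mul, mul_assoc]
      _ = star U * (U * Matrix.diagonal (fun i => (p i : ℂ)) * star U) * V := by
          simp only [mul_assoc]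
      _ = star U * (V * Matrix.diagonal (fun i => (q i : ℂ)) * star V) * V := by rw [← hsp, ← h]
      _ = star U * V * Matrix.diagonal (fun i => (q i : ℂ)) * (star V * V) := by
          simp only [mul_assoc]
      _ = _ := by rw [hVV', mul_one]
  have hpq : ∀ k i, (star U * V) k i ≠ 0 → p k = q i := by
    intro k i hki
    have := congrFun (congrFun hint k) i
    rw [Matrix.diagonal_mul, Matrix.mul_diagonal, mul_comm] at this
    exact_mod_cast mul_left_cancel₀ hki this
  have hX : star V * (ρ - σ) * V =
      star (star U * V) * (star U * (ρ - σ) * U) * (star U * V) := by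
    rw [star_mul, star_star]
    calc star V * (ρ - σ) * V
        = star V * (U * star U) * (ρ - σ) * (U * star U) * V := by
          rw [hUU, mul_one, mul_one]
      _ = _ := by simp only [mul_assoc]
  change diagChiSq p (star U * (ρ - σ) * U) = _
  rw [hX, diagChiSq_eq_add, diagChiSq_eq_add]
  rw [sum_weight_normSq_conj p q _ _ hW hpq fun s => if 0 < s then 2 * s⁻¹ else 0,
    sum_weight_normSq_conj p q _ _ hW hpq fun s => if 0 < s then 0 else 1]

end QuantumTesting

end

open QuantumTesting

/-! Work in an eigenbasis of σ with eigenvalues q, replace the weights 2/(qᵢ+qⱼ) by 2/(aᵢ+aⱼ) with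
aᵢ = qᵢ + δ and δ = θ/(10⁷d), and let χ be the resulting weighted square of ρ_avg − σ. Smoothing
only lowers the divergence, so the accept hypothesis gives χ ≤ .99θ. Conversely D_B² ≤ (1+η)χ +
(1+1/η)·4dδ (`buresDist_sq_le_weightedSq`), and dδ is a tiny multiple of θ, so the reject hypothesis
gives χ ≥ 1.005θ. It remains to tell these two ranges of χ apart.

The estimator is a U-statistic: `chiObservable` sums, over pairs of sites s < t, a weighted swap
operator centered at σ. Its mean is the sum over pairs of the weighted inner products of ρₛ − σ and
ρₜ − σ, that is, half of T²χ minus the diagonal terms. With X = ∑ₜ ∑ᵢ (ρₜ)ᵢᵢ/aᵢ, the bias is at most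
X + T, however far the single ρₜ are from σ. Recentering each site at its own ρₜ (a Hoeffding
decomposition) splits the fluctuation into a quadratic and a linear part, whose summands are
uncorrelated; the second moment is at most 9X² + 4T²χX + 8X (`chiObservable_moments`).

The quantity X depends on the average state only, and `sum_diag_div_le` bounds it by Td(O(1) +
χ/(2θ)), with no reference to the least eigenvalue of σ. For T ≥ 10¹⁷d/θ this is at most
10⁻¹⁰T²max(θ, χ), and Chebyshev's inequality at the threshold T²θ/2 concludes.

For the Bures bound, take square roots R and S of ρ + δ and σ + δ, and the positive M with M S² M =
R². The purifications M S and S differ by (M − 1)S, whose squared norm is at most tr S²(M² − 1)²,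
and this is bounded by the smoothed divergence through duality. -/

noncomputable section
namespace QuantumTesting
open Matrix
open scoped ComplexOrder

variable {d T : ℕ}

/-! ### Product states and operators on a single tensor factor -/

theorem productState_mul (A B : Fin T → Matrix (Fin d) (Fin d) ℂ) :
    productState A * productState B = productState (fun t => A t * B t) := by
  ext i j
  simp only [productState, Matrix.mul_apply, Matrix.of_apply, ← Finset.prod_mul_distrib]
  rw [Finset.prod_univ_sum, Fintype.piFinset_univ]

theorem trace_productState (A : Fin T → Matrix (Fin d) (Fin d) ℂ) :
    (productState A).trace = ∏ t, (A t).trace := by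
  simp only [productState, Matrix.trace, Matrix.diag, Matrix.of_apply]
  rw [Finset.prod_univ_sum, Fintype.piFinset_univ]

theorem productState_one : productState (fun _ : Fin T => (1 : Matrix (Fin d) (Fin d) ℂ)) = 1 := by
  ext i j
  simp only [productState, Matrix.of_apply, Matrix.one_apply]
  rw [Finset.prod_ite_zero]
  simp [funext_iff]

theorem conjTranspose_productState (A : Fin T → Matrix (Fin d) (Fin d) ℂ) :
    (productState A)ᴴ = productState (fun t => (A t)ᴴ) := by
  ext i j
  simp [productState, Matrix.conjTranspose_apply]

theorem exists_eq_conjTranspose_mul_self {n : Type*} [Fintype n] {A : Matrix n n ℂ}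
    (hA : A.PosSemidef) : ∃ B : Matrix n n ℂ, A = Bᴴ * B := by
  classical
  open scoped MatrixOrder in
  exact CStarAlgebra.nonneg_iff_eq_star_mul_self.1 (Matrix.nonneg_iff_posSemidef.2 hA)

theorem posSemidef_productState {A : Fin T → Matrix (Fin d) (Fin d) ℂ}
    (hA : ∀ t, (A t).PosSemidef) : (productState A).PosSemidef := by
  have : ∀ t, ∃ B : Matrix (Fin d) (Fin d) ℂ, A t = Bᴴ * B := fun t =>
    exists_eq_conjTranspose_mul_self (hA t)
  choose B hB using this
  have : productState A = (productState B)ᴴ * productState B := by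
    rw [conjTranspose_productState, productState_mul]
    congr 1
    exact funext hB
  rw [this]
  exact Matrix.posSemidef_conjTranspose_mul_self _

theorem isState_productState {ρ : Fin T → Matrix (Fin d) (Fin d) ℂ} (hρ : ∀ t, IsState (ρ t)) :
    IsState (productState ρ) :=
  ⟨posSemidef_productState fun t => (hρ t).posSemidef, by
    rw [trace_productState]; simp [(hρ _).trace_eq_one]⟩

/-- The operator acting as `X` on the tensor factor `t` and trivially on the others. -/
def siteOp (t : Fin T) : Matrix (Fin d) (Fin d) ℂ →ₗ[ℂ]
    Matrix (Fin T → Fin d) (Fin T → Fin d) ℂ where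
  toFun X := productState (Function.update (fun _ => 1) t X)
  map_add' X Y := by
    ext i j
    simp only [productState, Matrix.of_apply, Matrix.add_apply]
    rw [← Finset.mul_prod_erase _ _ (Finset.mem_univ t),
      ← Finset.mul_prod_erase _ _ (Finset.mem_univ t),
      ← Finset.mul_prod_erase _ _ (Finset.mem_univ t)]
    have h : ∀ Z : Matrix (Fin d) (Fin d) ℂ,
        ∏ s ∈ Finset.univ.erase t, (Function.update (fun _ => 1) t Z : Fin T → Matrix (Fin d) (Fin d) ℂ) s (i s) (j s) =
        ∏ s ∈ Finset.univ.erase t, (1 : Matrix (Fin d) (Fin d) ℂ) (i s) (j s) := fun Z =>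
      Finset.prod_congr rfl fun s hs => by
        rw [Function.update_of_ne (Finset.ne_of_mem_erase hs)]
    simp only [h, Function.update_self, Matrix.add_apply]
    ring
  map_smul' c X := by
    ext i j
    simp only [productState, Matrix.of_apply, Matrix.smul_apply, RingHom.id_apply]
    rw [← Finset.mul_prod_erase _ _ (Finset.mem_univ t),
      ← Finset.mul_prod_erase _ _ (Finset.mem_univ t)]
    have h : ∀ Z : Matrix (Fin d) (Fin d) ℂ,
        ∏ s ∈ Finset.univ.erase t, (Function.update (fun _ => 1) t Z : Fin T → Matrix (Fin d) (Fin d) ℂ) s (i s) (j s) =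
        ∏ s ∈ Finset.univ.erase t, (1 : Matrix (Fin d) (Fin d) ℂ) (i s) (j s) := fun Z =>
      Finset.prod_congr rfl fun s hs => by
        rw [Function.update_of_ne (Finset.ne_of_mem_erase hs)]
    simp only [h, Function.update_self, Matrix.smul_apply, smul_eq_mul]
    ring

theorem siteOp_apply (t : Fin T) (X : Matrix (Fin d) (Fin d) ℂ) :
    siteOp t X = productState (Function.update (fun _ => 1) t X) := rfl

theorem siteOp_one (t : Fin T) : siteOp t (1 : Matrix (Fin d) (Fin d) ℂ) = 1 := by
  rw [siteOp_apply, Function.update_eq_self_iff.2 rfl, productState_one]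

theorem conjTranspose_siteOp (t : Fin T) (X : Matrix (Fin d) (Fin d) ℂ) :
    (siteOp t X)ᴴ = siteOp t Xᴴ := by
  rw [siteOp_apply, siteOp_apply, conjTranspose_productState]
  congr 1
  funext s
  by_cases h : s = t
  · subst h; simp
  · simp [Function.update_of_ne h]

theorem siteOp_mul (s t : Fin T) (X Y : Matrix (Fin d) (Fin d) ℂ) :
    siteOp s X * siteOp t Y = productState (fun u =>
      Function.update (fun _ => 1) s X u * Function.update (fun _ => 1) t Y u) := by
  rw [siteOp_apply, siteOp_apply, productState_mul]

theorem siteOp_mul_comm {s t : Fin T} (h : s ≠ t) (X Y : Matrix (Fin d) (Fin d) ℂ) :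
    siteOp s X * siteOp t Y = siteOp t Y * siteOp s X := by
  rw [siteOp_mul, siteOp_mul]
  congr 1
  funext u
  by_cases hs : u = s
  · subst hs
    simp [Function.update_of_ne h]
  · simp [Function.update_of_ne hs]

theorem trace_productState_mul (ρ A : Fin T → Matrix (Fin d) (Fin d) ℂ) :
    (productState ρ * productState A).trace = ∏ t, (ρ t * A t).trace := by
  rw [productState_mul, trace_productState]

theorem trace_siteOp_mul_siteOp {ρ : Fin T → Matrix (Fin d) (Fin d) ℂ}
    (hρ : ∀ t, (ρ t).trace = 1) (t : Fin T) (X Y : Matrix (Fin d) (Fin d) ℂ) :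
    (productState ρ * (siteOp t X * siteOp t Y)).trace = (ρ t * (X * Y)).trace := by
  rw [siteOp_mul, trace_productState_mul, Finset.prod_eq_single t]
  · simp
  · intro s _ hs
    simp [Function.update_of_ne hs, hρ]
  · simp

theorem trace_siteOp_mul_siteOp_of_ne {ρ : Fin T → Matrix (Fin d) (Fin d) ℂ}
    {s t : Fin T} (hst : s ≠ t) (X Y : Matrix (Fin d) (Fin d) ℂ) (hX : (ρ s * X).trace = 0) :
    (productState ρ * (siteOp s X * siteOp t Y)).trace = 0 := by
  rw [siteOp_mul, trace_productState_mul]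
  refine Finset.prod_eq_zero (Finset.mem_univ s) ?_
  simp [Function.update_of_ne hst, hX]

theorem trace_pair_mul_pair {ρ : Fin T → Matrix (Fin d) (Fin d) ℂ}
    (hρ : ∀ t, (ρ t).trace = 1) {s t : Fin T} (hst : s ≠ t)
    (A B A' B' : Matrix (Fin d) (Fin d) ℂ) :
    (productState ρ * ((siteOp s A * siteOp t B) * (siteOp s A' * siteOp t B'))).trace =
      (ρ s * (A * A')).trace * (ρ t * (B * B')).trace := by
  rw [siteOp_mul, siteOp_mul, productState_mul, trace_productState_mul,
    Fintype.prod_eq_mul s t hst]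
  · simp [Function.update_of_ne hst, Function.update_of_ne hst.symm]
  · rintro u ⟨hs, ht⟩
    simp [Function.update_of_ne hs, Function.update_of_ne ht, hρ]

/-- A product of operators on two pairs of sites has expectation zero if some site is covered by
exactly one of the pairs and the operator there is centered. -/
theorem trace_pair_mul_pair_of_ne {ρ : Fin T → Matrix (Fin d) (Fin d) ℂ}
    {s t s' t' : Fin T} (hst : s < t) (hst' : s' < t') (hne : (s, t) ≠ (s', t'))
    {A B : Matrix (Fin d) (Fin d) ℂ} (A' B' : Matrix (Fin d) (Fin d) ℂ)
    (hA : (ρ s * A).trace = 0) (hB : (ρ t * B).trace = 0) :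
    (productState ρ * ((siteOp s A * siteOp t B) * (siteOp s' A' * siteOp t' B'))).trace = 0 := by
  rw [siteOp_mul, siteOp_mul, productState_mul, trace_productState_mul]
  -- Two distinct ordered pairs share at most one site, so if s lies in the second pair then t does
  -- not.
  by_cases h : s ≠ s' ∧ s ≠ t'
  · refine Finset.prod_eq_zero (Finset.mem_univ s) ?_
    simp [Function.update_of_ne hst.ne, Function.update_of_ne h.1, Function.update_of_ne h.2, hA]
  · have h2 : t ≠ s' ∧ t ≠ t' := by
      simp only [ne_eq, Prod.mk.injEq] at hne
      omega
    refine Finset.prod_eq_zero (Finset.mem_univ t) ?_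
    simp [Function.update_of_ne hst.ne', Function.update_of_ne h2.1, Function.update_of_ne h2.2, hB]

/-! ### Positivity of expectations and Chebyshev's inequality for observables -/

section Chebyshev
variable {n : Type*} [Fintype n]

theorem trace_mul_re_nonneg {ρ A : Matrix n n ℂ} (hρ : ρ.PosSemidef) (hA : A.PosSemidef) :
    0 ≤ (ρ * A).trace.re := by
  obtain ⟨B, rfl⟩ := exists_eq_conjTranspose_mul_self hA
  rw [← mul_assoc, Matrix.trace_mul_comm, ← mul_assoc]
  exact (Complex.le_def.1 (hρ.mul_mul_conjTranspose_same B).trace_nonneg).1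

theorem trace_mul_conjTranspose_mul_self_re_nonneg {ρ : Matrix n n ℂ} (hρ : ρ.PosSemidef)
    (A : Matrix n n ℂ) : 0 ≤ (ρ * (Aᴴ * A)).trace.re :=
  trace_mul_re_nonneg hρ (Matrix.posSemidef_conjTranspose_mul_self A)

/-- Parallelogram law: the second moment of A − B is nonnegative. -/
theorem trace_conjTranspose_mul_self_add_le {ρ : Matrix n n ℂ} (hρ : ρ.PosSemidef)
    (A B : Matrix n n ℂ) :
    (ρ * ((A + B)ᴴ * (A + B))).trace.re ≤
      2 * (ρ * (Aᴴ * A)).trace.re + 2 * (ρ * (Bᴴ * B)).trace.re := by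
  have h := trace_mul_conjTranspose_mul_self_re_nonneg hρ (A - B)
  simp only [Matrix.conjTranspose_sub, Matrix.conjTranspose_add, mul_add, mul_sub, add_mul, sub_mul,
    Matrix.trace_add, Matrix.trace_sub, Complex.add_re, Complex.sub_re] at h ⊢
  linarith

variable [DecidableEq n]

/-- The test accepting when the outcome of measuring a Hermitian observable is at most `τ`; its
error probabilities are controlled by Chebyshev's inequality. -/
theorem exists_test_of_isHermitian {N : Matrix n n ℂ} (hN : N.IsHermitian) (τ : ℝ) :
    ∃ A : Test n, ∀ ρ : Matrix n n ℂ, IsState ρ → ∀ m v : ℝ,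
      (ρ * ((N - (m : ℂ) • 1)ᴴ * (N - (m : ℂ) • 1))).trace.re ≤ v →
      (∀ g : ℝ, 0 < g → m + g ≤ τ → v ≤ g ^ 2 / 100 → 99 / 100 ≤ A.acceptProb ρ) ∧
      (∀ g : ℝ, 0 < g → τ + g ≤ m → v ≤ g ^ 2 / 100 → 99 / 100 ≤ A.rejectProb ρ) := by
  set U : Matrix n n ℂ := hN.eigenvectorUnitary.1 with hU
  set l := hN.eigenvalues with hl
  have hUU : U * star U = 1 := Matrix.mem_unitaryGroup_iff.1 hN.eigenvectorUnitary.2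
  have hUU' : star U * U = 1 := Matrix.mem_unitaryGroup_iff'.1 hN.eigenvectorUnitary.2
  have hsp : N = U * Matrix.diagonal (fun i => (l i : ℂ)) * star U := by
    have := hN.spectral_theorem
    rw [Unitary.conjStarAlgAut_apply] at this
    exact this
  let D : (n → ℝ) → Matrix n n ℂ := fun f => U * Matrix.diagonal (fun i => (f i : ℂ)) * Uᴴ
  have hUH : Uᴴ = star U := rfl
  have hD1 : D (fun _ => 1) = 1 := by
    simp only [D, Complex.ofReal_one, Matrix.diagonal_one, mul_one, hUH, hUU]
  have hDpos : ∀ f : n → ℝ, (∀ i, 0 ≤ f i) → (D f).PosSemidef := fun f hf =>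
    (Matrix.PosSemidef.diagonal (fun i => by
      simpa using hf i)).mul_mul_conjTranspose_same U
  have hDsub : ∀ f g : n → ℝ, D f - D g = D (f - g) := by
    intro f g
    simp only [D, ← sub_mul, ← mul_sub, Matrix.diagonal_sub, Pi.sub_apply, Complex.ofReal_sub]
  have hDsq : ∀ f : n → ℝ, (D f)ᴴ * D f = D (fun i => f i ^ 2) := by
    intro f
    have : (D f)ᴴ = D f := by
      simp only [D, Matrix.conjTranspose_mul, Matrix.conjTranspose_conjTranspose,
        Matrix.diagonal_conjTranspose, mul_assoc]
      congr 3
      ext i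
      simp
    rw [this]
    simp only [D]
    calc U * Matrix.diagonal (fun i => (f i : ℂ)) * Uᴴ *
          (U * Matrix.diagonal (fun i => (f i : ℂ)) * Uᴴ)
        = U * Matrix.diagonal (fun i => (f i : ℂ)) * (star U * U) *
          (Matrix.diagonal (fun i => (f i : ℂ)) * Uᴴ) := by simp only [mul_assoc, hUH]
      _ = U * (Matrix.diagonal (fun i => (f i : ℂ)) * Matrix.diagonal (fun i => (f i : ℂ))) * Uᴴ := by
          rw [hUU', mul_one]; simp only [mul_assoc]
      _ = _ := by rw [Matrix.diagonal_mul_diagonal]; simp only [Complex.ofReal_mul, pow_two]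
  have hmono : ∀ ρ : Matrix n n ℂ, IsState ρ → ∀ f g : n → ℝ, (∀ i, f i ≤ g i) →
      (ρ * D f).trace.re ≤ (ρ * D g).trace.re := by
    intro ρ hρ f g hfg
    have := trace_mul_re_nonneg hρ.posSemidef (hDpos (g - f) fun i => sub_nonneg.2 (hfg i))
    rw [← hDsub, mul_sub, Matrix.trace_sub, Complex.sub_re] at this
    linarith
  have hsmul : ∀ (ρ : Matrix n n ℂ) (c : ℝ) (f : n → ℝ),
      (ρ * D (fun i => c * f i)).trace.re = c * (ρ * D f).trace.re := by
    intro ρ c f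
    have : D (fun i => c * f i) = (c : ℂ) • D f := by
      simp only [D, Complex.ofReal_mul]
      rw [← Matrix.smul_mul, ← Matrix.mul_smul, ← Matrix.diagonal_smul]
      rfl
    rw [this, Matrix.mul_smul, Matrix.trace_smul, smul_eq_mul, Complex.re_ofReal_mul]
  let p : n → ℝ := fun i => if l i ≤ τ then 1 else 0
  have hp1 : (1 : Matrix n n ℂ) - D p = D (fun i => if l i ≤ τ then 0 else 1) := by
    rw [← hD1, hDsub]
    congr 1
    funext i
    simp only [Pi.sub_apply, p]
    split_ifs <;> simp
  have hND : ∀ m : ℝ, N - (m : ℂ) • 1 = D (fun i => l i - m) := by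
    intro m
    have h1 : N = D l := hsp
    have h2 : (m : ℂ) • (1 : Matrix n n ℂ) = D (fun _ => m) := by
      rw [← hD1]
      simp only [D]
      rw [← Matrix.smul_mul, ← Matrix.mul_smul, ← Matrix.diagonal_smul]
      congr 3
      ext i
      simp
    rw [h2]
    nth_rw 1 [h1]
    exact hDsub _ _
  have hpos : (D p).PosSemidef := hDpos p fun i => by
    simp only [p]; split_ifs <;> norm_num
  have hpos' : (1 - D p).PosSemidef := by
    rw [hp1]
    refine hDpos _ fun i => ?_
    split_ifs <;> norm_num
  refine ⟨⟨D p, hpos, hpos'⟩, ?_⟩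
  intro ρ hρ m v hv
  rw [hND, hDsq] at hv
  have htot : (ρ * D p).trace.re + (ρ * (1 - D p)).trace.re = 1 := by
    rw [mul_sub, Matrix.trace_sub, Complex.sub_re, mul_one, hρ.trace_eq_one]
    simp
  constructor
  · intro g hg hτ hvg
    -- Chebyshev: the indicator of an eigenvalue above τ ≥ m + g is dominated by (l − m)²/g².
    have h := hmono ρ hρ (fun i => if l i ≤ τ then 0 else 1)
      (fun i => (g ^ 2)⁻¹ * (l i - m) ^ 2) fun i => by
        split_ifs with h
        · positivity
        · rw [inv_mul_eq_div, le_div_iff₀ (by positivity), one_mul]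
          exact pow_le_pow_left₀ hg.le (by linarith) 2
    rw [hsmul] at h
    simp only [Test.acceptProb]
    have h3 : (ρ * (1 - D p)).trace.re ≤ 1 / 100 := by
      rw [hp1]
      refine h.trans ?_
      rw [inv_mul_eq_div, div_le_iff₀ (by positivity)]
      linarith
    linarith
  · intro g hg hτ hvg
    have h := hmono ρ hρ p
      (fun i => (g ^ 2)⁻¹ * (l i - m) ^ 2) fun i => by
        simp only [p]
        split_ifs with h
        · rw [inv_mul_eq_div, le_div_iff₀ (by positivity), one_mul, ← neg_sq (l i - m)]
          exact pow_le_pow_left₀ hg.le (by linarith) 2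
        · positivity
    rw [hsmul] at h
    simp only [Test.rejectProb]
    have h3 : (ρ * D p).trace.re ≤ 1 / 100 := by
      refine h.trans ?_
      rw [inv_mul_eq_div, div_le_iff₀ (by positivity)]
      linarith
    linarith

end Chebyshev
-- Centering an operator at a state
section Center
variable {n ι : Type*} [Fintype n] [DecidableEq n] [Fintype ι]

/-- The operator `A` minus its expectation in the state `ρ`. -/
def center (ρ : Matrix n n ℂ) : Matrix n n ℂ →ₗ[ℂ] Matrix n n ℂ where
  toFun A := A - (ρ * A).trace • 1
  map_add' A B := by
    simp only [mul_add, Matrix.trace_add, add_smul]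
    abel
  map_smul' c A := by
    simp only [Matrix.mul_smul, Matrix.trace_smul, smul_eq_mul, mul_smul, RingHom.id_apply,
      smul_sub]

theorem center_apply (ρ A : Matrix n n ℂ) : center ρ A = A - (ρ * A).trace • 1 := rfl

theorem trace_mul_center {ρ : Matrix n n ℂ} (hρ : ρ.trace = 1) (A : Matrix n n ℂ) :
    (ρ * center ρ A).trace = 0 := by
  simp [center_apply, mul_sub, hρ]

omit [DecidableEq n] in
theorem trace_mul_conjTranspose {ρ : Matrix n n ℂ} (hρ : ρ.IsHermitian) (A : Matrix n n ℂ) :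
    (ρ * Aᴴ).trace = star (ρ * A).trace := by
  rw [← Matrix.trace_conjTranspose, Matrix.conjTranspose_mul, hρ.eq, Matrix.trace_mul_comm]

theorem conjTranspose_center {ρ : Matrix n n ℂ} (hρ : ρ.IsHermitian) (A : Matrix n n ℂ) :
    (center ρ A)ᴴ = center ρ Aᴴ := by
  simp [center_apply, Matrix.conjTranspose_sub, Matrix.conjTranspose_smul,
    trace_mul_conjTranspose hρ]

theorem trace_center_mul_center {ρ : Matrix n n ℂ} (hρ : IsState ρ) (A B : Matrix n n ℂ) :
    (ρ * ((center ρ A)ᴴ * center ρ B)).trace =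
      (ρ * (Aᴴ * B)).trace - star (ρ * A).trace * (ρ * B).trace := by
  rw [conjTranspose_center hρ.posSemidef.isHermitian]
  simp only [center_apply, mul_sub, sub_mul, Matrix.trace_sub, Matrix.smul_mul, Matrix.mul_smul,
    one_mul, mul_one, Matrix.trace_smul, hρ.trace_eq_one, smul_eq_mul,
    trace_mul_conjTranspose hρ.posSemidef.isHermitian]
  ring

/-- This turns operators centered at σ, as in the observable, into operators centered at the actual
state of their site plus a scalar. -/
theorem center_eq_add (ρ σ A : Matrix n n ℂ) :
    center σ A = center ρ A + ((ρ - σ) * A).trace • 1 := by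
  simp only [center_apply, sub_mul, Matrix.trace_sub, sub_smul]
  abel

/-- Centering replaces second moments by covariances. The subtracted part is the second moment in τ
of ∑ tr(ρ A_α) B_α, hence nonnegative. -/
theorem sum_trace_center_left_le {ρ τ : Matrix n n ℂ} (hρ : IsState ρ) (hτ : τ.PosSemidef)
    (A B : ι → Matrix n n ℂ) :
    (∑ α, ∑ β, (ρ * ((center ρ (A α))ᴴ * center ρ (A β))).trace *
        (τ * ((B α)ᴴ * B β)).trace).re ≤
      (∑ α, ∑ β, (ρ * ((A α)ᴴ * A β)).trace * (τ * ((B α)ᴴ * B β)).trace).re := by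
  have h := trace_mul_conjTranspose_mul_self_re_nonneg hτ (∑ α, (ρ * A α).trace • B α)
  have h2 : (τ * ((∑ α, (ρ * A α).trace • B α)ᴴ * (∑ α, (ρ * A α).trace • B α))).trace =
      ∑ α, ∑ β, star (ρ * A α).trace * (ρ * A β).trace * (τ * ((B α)ᴴ * B β)).trace := by
    simp only [Matrix.conjTranspose_sum, Matrix.conjTranspose_smul, Finset.sum_mul, Finset.mul_sum,
      Matrix.trace_sum, Matrix.smul_mul, Matrix.mul_smul, Matrix.trace_smul, smul_eq_mul]
    rw [Finset.sum_comm]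
    refine Finset.sum_congr rfl fun α _ => Finset.sum_congr rfl fun β _ => ?_
    ring
  rw [h2] at h
  simp only [trace_center_mul_center hρ, sub_mul, Finset.sum_sub_distrib, Complex.sub_re]
  linarith

theorem sum_trace_center_center_le {ρ τ : Matrix n n ℂ} (hρ : IsState ρ) (hτ : IsState τ)
    (A B : ι → Matrix n n ℂ) :
    (∑ α, ∑ β, (ρ * ((center ρ (A α))ᴴ * center ρ (A β))).trace *
        (τ * ((center τ (B α))ᴴ * center τ (B β))).trace).re ≤
      (∑ α, ∑ β, (ρ * ((A α)ᴴ * A β)).trace * (τ * ((B α)ᴴ * B β)).trace).re := by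
  refine (sum_trace_center_left_le hρ hτ.posSemidef A fun α => center τ (B α)).trans ?_
  have h := sum_trace_center_left_le hτ hρ.posSemidef B A
  simpa only [mul_comm] using h

end Center

/-! ### Cauchy–Schwarz bounds for matrix entries -/

section Frobenius
variable {n m : Type*} [Fintype n] [Fintype m]

theorem trace_conjTranspose_mul_self_re (A : Matrix m n ℂ) :
    (Aᴴ * A).trace.re = ∑ i, ∑ j, ‖A i j‖ ^ 2 := by
  have : (Aᴴ * A).trace = ((∑ i, ∑ j, ‖A i j‖ ^ 2 : ℝ) : ℂ) := by
    simp only [Matrix.trace, Matrix.diag, Matrix.mul_apply, Matrix.conjTranspose_apply]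
    rw [Finset.sum_comm]
    push_cast
    refine Finset.sum_congr rfl fun i _ => Finset.sum_congr rfl fun j _ => ?_
    rw [← Complex.conj_mul']
    rfl
  rw [this, Complex.ofReal_re]

theorem norm_sum_mul_sq_le {a : n → ℝ} (ha : ∀ i, 0 < a i) (x y : n → ℂ) :
    ‖∑ i, x i * y i‖ ^ 2 ≤ (∑ i, a i * ‖x i‖ ^ 2) * ∑ i, ‖y i‖ ^ 2 / a i := by
  calc ‖∑ i, x i * y i‖ ^ 2 ≤ (∑ i, ‖x i‖ * ‖y i‖) ^ 2 := by
        refine pow_le_pow_left₀ (norm_nonneg _) ((norm_sum_le _ _).trans (le_of_eq ?_)) 2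
        simp only [norm_mul]
    _ ≤ _ := by
        refine Finset.sum_sq_le_sum_mul_sum_of_sq_le_mul _ (fun i _ => ?_) (fun i _ => ?_)
          fun i _ => ?_
        · have := (ha i).le; positivity
        · have := (ha i).le; positivity
        · have := (ha i).ne'; exact le_of_eq (by field_simp)

theorem diag_re_eq_sum {B : Matrix n n ℂ} (i : n) :
    ((Bᴴ * B) i i).re = ∑ l, ‖B l i‖ ^ 2 := by
  have : (Bᴴ * B) i i = ((∑ l, ‖B l i‖ ^ 2 : ℝ) : ℂ) := by
    simp only [Matrix.mul_apply, Matrix.conjTranspose_apply]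
    push_cast
    refine Finset.sum_congr rfl fun j _ => ?_
    rw [← Complex.conj_mul']
    rfl
  rw [this, Complex.ofReal_re]

/-- With ρ = Bᴴ B the left side is the squared Frobenius norm of B Gᴴ; weighted Cauchy–Schwarz
applies to each of its entries. -/
theorem trace_mul_conjTranspose_mul_self_le {ρ : Matrix n n ℂ} (hρ : ρ.PosSemidef) {a : n → ℝ}
    (ha : ∀ i, 0 < a i) (G : Matrix n n ℂ) :
    (ρ * (Gᴴ * G)).trace.re ≤ (∑ i, (ρ i i).re / a i) * ∑ k, ∑ i, a i * ‖G k i‖ ^ 2 := by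
  obtain ⟨B, rfl⟩ := exists_eq_conjTranspose_mul_self hρ
  have h : (Bᴴ * B * (Gᴴ * G)).trace = ((B * Gᴴ)ᴴ * (B * Gᴴ)).trace := by
    rw [Matrix.conjTranspose_mul, Matrix.conjTranspose_conjTranspose, Matrix.mul_assoc,
      Matrix.trace_mul_comm Bᴴ,
      Matrix.trace_mul_comm (G * Bᴴ)]
    simp only [Matrix.mul_assoc]
  rw [h, trace_conjTranspose_mul_self_re]
  simp only [diag_re_eq_sum, Finset.sum_div]
  rw [Finset.sum_comm (f := fun i l => ‖B l i‖ ^ 2 / a i), Finset.sum_mul_sum]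
  refine Finset.sum_le_sum fun l _ => Finset.sum_le_sum fun k _ => ?_
  simp only [Matrix.mul_apply, Matrix.conjTranspose_apply]
  have := norm_sum_mul_sq_le ha (fun i => star (G k i)) (fun i => B l i)
  simp only [norm_star] at this
  rw [mul_comm (∑ i, ‖B l i‖ ^ 2 / a i)]
  simpa only [mul_comm] using this

theorem norm_apply_sq_le {ρ : Matrix n n ℂ} (hρ : ρ.PosSemidef) (i j : n) :
    ‖ρ i j‖ ^ 2 ≤ (ρ i i).re * (ρ j j).re := by
  obtain ⟨B, rfl⟩ := exists_eq_conjTranspose_mul_self hρ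
  rw [diag_re_eq_sum, diag_re_eq_sum]
  have := norm_sum_mul_sq_le (a := fun _ => 1) (fun _ => one_pos) (fun l => star (B l i))
    (fun l => B l j)
  simpa [Matrix.mul_apply] using this

theorem diag_re_nonneg {ρ : Matrix n n ℂ} (hρ : ρ.PosSemidef) (i : n) : 0 ≤ (ρ i i).re := by
  obtain ⟨B, rfl⟩ := exists_eq_conjTranspose_mul_self hρ
  rw [diag_re_eq_sum]
  positivity

theorem sum_diag_re {ρ : Matrix n n ℂ} (hρ : IsState ρ) : ∑ i, (ρ i i).re = 1 := by
  have := congrArg Complex.re hρ.trace_eq_one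
  simpa [Matrix.trace] using this

end Frobenius

/-! ### The weighted norm with weights 2/(aᵢ + aⱼ) -/

section Weight
variable {n : Type*}

/-- The weights `2 / (aᵢ + aⱼ)` of the Bures `χ²`-divergence. -/
def weight (a : n → ℝ) (i j : n) : ℝ := 2 / (a i + a j)

/-- The weighted squared norm `∑ i j, 2 / (aᵢ + aⱼ) |Xᵢⱼ|²`. -/
def weightedSq [Fintype n] (a : n → ℝ) (X : Matrix n n ℂ) : ℝ := ∑ i, ∑ j, weight a i j * ‖X i j‖ ^ 2

/-- The entrywise product of a matrix with the weights `2 / (aᵢ + aⱼ)`. -/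
def weightMul (a : n → ℝ) : Matrix n n ℂ →ₗ[ℂ] Matrix n n ℂ where
  toFun X := Matrix.of fun i j => (weight a i j : ℂ) * X i j
  map_add' X Y := by ext; simp [mul_add]
  map_smul' c X := by ext; simp [mul_left_comm]

theorem weightMul_apply (a : n → ℝ) (X : Matrix n n ℂ) (i j : n) :
    weightMul a X i j = (weight a i j : ℂ) * X i j := rfl

theorem weight_comm (a : n → ℝ) (i j : n) : weight a i j = weight a j i := by
  rw [weight, weight, add_comm]

variable {a : n → ℝ} (ha : ∀ i, 0 < a i)
include ha

theorem weight_pos (i j : n) : 0 < weight a i j := div_pos two_pos (add_pos (ha i) (ha j))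

theorem weight_le (i j : n) : weight a i j ≤ (1 / a i + 1 / a j) / 2 := by
  have hi := ha i
  have hj := ha j
  rw [weight, div_add_div _ _ hi.ne' hj.ne', div_div, div_le_div_iff₀ (by positivity) (by positivity)]
  nlinarith [sq_nonneg (a i - a j)]

theorem weight_sq_le (i j : n) : weight a i j ^ 2 ≤ 1 / (a i * a j) := by
  have hi := ha i
  have hj := ha j
  rw [weight, div_pow, div_le_div_iff₀ (by positivity) (by positivity)]
  nlinarith [sq_nonneg (a i - a j)]

variable [Fintype n]

theorem weightedSq_nonneg (X : Matrix n n ℂ) : 0 ≤ weightedSq a X :=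
  Finset.sum_nonneg fun i _ => Finset.sum_nonneg fun j _ =>
    mul_nonneg (weight_pos ha i j).le (sq_nonneg _)

theorem weightedSq_sub_le (X Y : Matrix n n ℂ) :
    weightedSq a (X - Y) ≤ 2 * weightedSq a X + 2 * weightedSq a Y := by
  simp only [weightedSq, Finset.mul_sum, ← Finset.sum_add_distrib]
  refine Finset.sum_le_sum fun i _ => Finset.sum_le_sum fun j _ => ?_
  have hw := (weight_pos ha i j).le
  have h1 : ‖(X - Y) i j‖ ≤ ‖X i j‖ + ‖Y i j‖ := norm_sub_le _ _
  have h2 : ‖(X - Y) i j‖ ^ 2 ≤ 2 * ‖X i j‖ ^ 2 + 2 * ‖Y i j‖ ^ 2 := by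
    have := pow_le_pow_left₀ (norm_nonneg _) h1 2
    nlinarith [sq_nonneg (‖X i j‖ - ‖Y i j‖)]
  nlinarith [mul_le_mul_of_nonneg_left h2 hw]

omit ha in
theorem weightedSq_smul (c : ℝ) (X : Matrix n n ℂ) :
    weightedSq a ((c : ℂ) • X) = c ^ 2 * weightedSq a X := by
  simp only [weightedSq, Finset.mul_sum]
  refine Finset.sum_congr rfl fun i _ => Finset.sum_congr rfl fun j _ => ?_
  simp only [Matrix.smul_apply, norm_smul, Complex.norm_real, mul_pow, Real.norm_eq_abs, sq_abs]
  ring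

/-- Combines |ρᵢⱼ|² ≤ ρᵢᵢ ρⱼⱼ with the bound of the weight by the mean of 1/aᵢ and 1/aⱼ; one
diagonal factor then sums to one. -/
theorem weightedSq_le_of_isState {ρ : Matrix n n ℂ} (hρ : IsState ρ) :
    weightedSq a ρ ≤ ∑ i, (ρ i i).re / a i := by
  have h1 := sum_diag_re hρ
  calc weightedSq a ρ ≤ ∑ i, ∑ j, ((ρ i i).re / a i * (ρ j j).re / 2 +
        (ρ i i).re * ((ρ j j).re / a j) / 2) := by
        refine Finset.sum_le_sum fun i _ => Finset.sum_le_sum fun j _ => ?_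
        have h2 := mul_nonneg (diag_re_nonneg hρ.posSemidef i) (diag_re_nonneg hρ.posSemidef j)
        refine (mul_le_mul (weight_le ha i j) (norm_apply_sq_le hρ.posSemidef i j) (by positivity)
          ?_).trans (le_of_eq (by ring))
        have := ha i
        have := ha j
        positivity
    _ = _ := by
        simp only [Finset.sum_add_distrib, ← Finset.sum_div, ← Finset.mul_sum, ← Finset.sum_mul, h1]
        ring

/-- Since |Xᵢⱼ| is symmetric, aᵢ may be replaced by (aᵢ + aⱼ)/2, which cancels one of the two
factors 2/(aᵢ + aⱼ). -/
theorem sum_norm_weightMul_sq {X : Matrix n n ℂ}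
    (hX : X.IsHermitian) :
    ∑ k, ∑ i, a i * ‖weightMul a X k i‖ ^ 2 = weightedSq a X := by
  have hs : ∀ k i, ‖X k i‖ = ‖X i k‖ := fun k i => by
    rw [← hX.apply k i, norm_star]
  have h1 : ∑ k, ∑ i, a i * ‖weightMul a X k i‖ ^ 2 = ∑ k, ∑ i, a k * ‖weightMul a X k i‖ ^ 2 := by
    rw [Finset.sum_comm]
    refine Finset.sum_congr rfl fun k _ => Finset.sum_congr rfl fun i _ => ?_
    rw [weightMul_apply, weightMul_apply, weight_comm, norm_mul, norm_mul, hs]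
  have h2 : ∑ k, ∑ i, a i * ‖weightMul a X k i‖ ^ 2 + ∑ k, ∑ i, a k * ‖weightMul a X k i‖ ^ 2 =
      2 * weightedSq a X := by
    simp only [weightedSq, Finset.mul_sum, ← Finset.sum_add_distrib]
    refine Finset.sum_congr rfl fun k _ => Finset.sum_congr rfl fun i _ => ?_
    have := (add_pos (ha k) (ha i)).ne'
    rw [weightMul_apply, norm_mul, Complex.norm_real, Real.norm_eq_abs, mul_pow, sq_abs, weight]
    field_simp
    ring
  linarith

end Weight

theorem weightedSq_diagonal_le {a q : Fin d → ℝ} (ha : ∀ i, 0 < a i) (hq : ∀ i, 0 ≤ q i)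
    (hqa : ∀ i, q i ≤ a i) (hq1 : ∑ i, q i = 1) :
    weightedSq a (Matrix.diagonal fun i => (q i : ℂ)) ≤ 1 := by
  rw [← hq1, weightedSq]
  refine Finset.sum_le_sum fun i _ => ?_
  rw [Finset.sum_eq_single i]
  · have := ha i
    rw [Matrix.diagonal_apply_eq, Complex.norm_real, Real.norm_eq_abs, sq_abs, weight,
      div_mul_eq_mul_div, div_le_iff₀ (by positivity)]
    nlinarith [hq i, hqa i]
  · intro j _ hj
    simp [Matrix.diagonal_apply_ne' _ hj]
  · simp

/-! ### The observable and its Hoeffding decomposition -/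

/-- The pairs of sites, each listed once. -/
def ltPairs (T : ℕ) : Finset (Fin T × Fin T) := Finset.univ.filter fun p => p.1 < p.2

theorem sum_ltPairs_add_swap {M : Type*} [AddCommGroup M] (f : Fin T → Fin T → M) :
    ∑ p ∈ ltPairs T, (f p.1 p.2 + f p.2 p.1) = ∑ s, ∑ t, f s t - ∑ t, f t t := by
  have h1 : ∑ p ∈ ltPairs T, f p.1 p.2 = ∑ s, ∑ t, if s < t then f s t else 0 := by
    rw [ltPairs, Finset.sum_filter, Fintype.sum_prod_type]
  have h2 : ∑ p ∈ ltPairs T, f p.2 p.1 = ∑ s, ∑ t, if t < s then f s t else 0 := by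
    rw [ltPairs, Finset.sum_filter, Fintype.sum_prod_type, Finset.sum_comm]
  have h3 : ∑ t, f t t = ∑ s, ∑ t, if s = t then f s t else 0 := by simp
  rw [Finset.sum_add_distrib, h1, h2, h3, eq_sub_iff_add_eq]
  simp only [← Finset.sum_add_distrib]
  refine Finset.sum_congr rfl fun s _ => Finset.sum_congr rfl fun t _ => ?_
  rcases lt_trichotomy s t with h | h | h
  · simp [h, h.not_gt, h.ne]
  · simp [h]
  · simp [h, h.not_gt, h.ne']

/-- The matrix unit at `(i, j)` times the weight `2 / (aᵢ + aⱼ)`. -/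
def weightedUnit (a : Fin d → ℝ) (α : Fin d × Fin d) : Matrix (Fin d) (Fin d) ℂ :=
  (weight a α.1 α.2 : ℂ) • Matrix.single α.1 α.2 1

/-- The matrix unit at `(j, i)`. -/
def swapUnit (α : Fin d × Fin d) : Matrix (Fin d) (Fin d) ℂ := Matrix.single α.2 α.1 1

theorem trace_mul_weightedUnit (a : Fin d → ℝ) (X : Matrix (Fin d) (Fin d) ℂ)
    (α : Fin d × Fin d) : (X * weightedUnit a α).trace = weightMul a X α.2 α.1 := by
  rw [weightedUnit, Matrix.mul_smul, Matrix.trace_smul, Matrix.trace_mul_comm,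
    Matrix.trace_single_mul, weightMul_apply, weight_comm]
  simp

theorem trace_mul_swapUnit (X : Matrix (Fin d) (Fin d) ℂ) (α : Fin d × Fin d) :
    (X * swapUnit α).trace = X α.1 α.2 := by
  rw [swapUnit, Matrix.trace_mul_comm, Matrix.trace_single_mul]
  simp

theorem sum_smul_swapUnit (a : Fin d → ℝ) (X : Matrix (Fin d) (Fin d) ℂ) :
    ∑ α, weightMul a X α.2 α.1 • swapUnit α = weightMul a X := by
  rw [Fintype.sum_prod_type, Finset.sum_comm]
  simp only [swapUnit, Matrix.smul_single, smul_eq_mul, mul_one]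
  exact (Matrix.matrix_eq_sum_single _).symm

theorem sum_smul_weightedUnit (a : Fin d → ℝ) (X : Matrix (Fin d) (Fin d) ℂ) :
    ∑ α : Fin d × Fin d, X α.1 α.2 • weightedUnit a α = weightMul a X := by
  rw [Fintype.sum_prod_type]
  simp only [weightedUnit, Matrix.smul_single, smul_eq_mul, mul_one]
  rw [Matrix.matrix_eq_sum_single (weightMul a X)]
  refine Finset.sum_congr rfl fun i _ => Finset.sum_congr rfl fun j _ => ?_
  rw [weightMul_apply, mul_comm]

/-- The weighted swap operator on the sites `s` and `t`, centered at the states `ρ` and `τ`. -/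
def pairOp (a : Fin d → ℝ) (ρ τ : Matrix (Fin d) (Fin d) ℂ) (s t : Fin T) :
    Matrix (Fin T → Fin d) (Fin T → Fin d) ℂ :=
  ∑ α, siteOp s (center ρ (weightedUnit a α)) * siteOp t (center τ (swapUnit α))

/-- The observable estimating the weighted squared distance of the average state from `σ`. -/
def chiObservable (T : ℕ) (a : Fin d → ℝ) (σ : Matrix (Fin d) (Fin d) ℂ) :
    Matrix (Fin T → Fin d) (Fin T → Fin d) ℂ :=
  ∑ p ∈ ltPairs T, pairOp a σ σ p.1 p.2

theorem conjTranspose_weightedUnit (a : Fin d → ℝ) (α : Fin d × Fin d) :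
    (weightedUnit a α)ᴴ = weightedUnit a α.swap := by
  simp [weightedUnit, weight_comm a α.1, Matrix.conjTranspose_single]

theorem conjTranspose_swapUnit (α : Fin d × Fin d) : (swapUnit α)ᴴ = swapUnit α.swap := by
  simp [swapUnit, Matrix.conjTranspose_single]

theorem isHermitian_chiObservable (a : Fin d → ℝ) {σ : Matrix (Fin d) (Fin d) ℂ}
    (hσ : σ.IsHermitian) : (chiObservable T a σ).IsHermitian := by
  rw [chiObservable, Matrix.IsHermitian, Matrix.conjTranspose_sum]
  refine Finset.sum_congr rfl fun p hp => ?_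
  have hp : p.1 < p.2 := (Finset.mem_filter.1 hp).2
  rw [pairOp, Matrix.conjTranspose_sum, ← Equiv.sum_comp (Equiv.prodComm _ _)]
  refine Finset.sum_congr rfl fun α _ => ?_
  rw [Matrix.conjTranspose_mul, conjTranspose_siteOp, conjTranspose_siteOp,
    conjTranspose_center hσ, conjTranspose_center hσ, conjTranspose_weightedUnit,
    conjTranspose_swapUnit, siteOp_mul_comm hp.ne']
  simp

/-- The bilinear form whose quadratic form on Hermitian matrices is `weightedSq`. -/
def weightedPairing (a : Fin d → ℝ) (X Y : Matrix (Fin d) (Fin d) ℂ) : ℂ :=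
  ∑ α : Fin d × Fin d, weightMul a X α.2 α.1 * Y α.1 α.2

theorem weightedPairing_comm (a : Fin d → ℝ) (X Y : Matrix (Fin d) (Fin d) ℂ) :
    weightedPairing a X Y = weightedPairing a Y X := by
  rw [weightedPairing, weightedPairing, ← Equiv.sum_comp (Equiv.prodComm _ _)]
  refine Finset.sum_congr rfl fun α _ => ?_
  simp only [weightMul_apply, Equiv.prodComm_apply, Prod.fst_swap, Prod.snd_swap,
    weight_comm a α.1]
  ring

theorem weightedPairing_self (a : Fin d → ℝ) {X : Matrix (Fin d) (Fin d) ℂ}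
    (hX : X.IsHermitian) : weightedPairing a X X = (weightedSq a X : ℂ) := by
  rw [weightedPairing, weightedSq, Fintype.sum_prod_type]
  push_cast
  refine Finset.sum_congr rfl fun i _ => Finset.sum_congr rfl fun j _ => ?_
  rw [weightMul_apply, weight_comm, mul_assoc, ← Complex.conj_mul', ← hX.apply j i]
  rfl

theorem sum_sum_weightedPairing (a : Fin d → ℝ) (X : Fin T → Matrix (Fin d) (Fin d) ℂ) :
    ∑ s, ∑ t, weightedPairing a (X s) (X t) = weightedPairing a (∑ t, X t) (∑ t, X t) := by
  simp only [weightedPairing, map_sum, Matrix.sum_apply, Finset.sum_mul_sum]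
  rw [Finset.sum_comm]
  refine (Finset.sum_congr rfl fun t _ => Finset.sum_comm).trans ?_
  rw [Finset.sum_comm]
  exact Finset.sum_congr rfl fun α _ => Finset.sum_comm

/-- Hoeffding decomposition of one pair: a part centered at both sites, two single-site parts, and
the mean. It comes from expanding the product after recentering each factor. -/
theorem pairOp_eq_add (s t : Fin T) (a : Fin d → ℝ)
    (σ ρ τ : Matrix (Fin d) (Fin d) ℂ) :
    pairOp a σ σ s t = pairOp a ρ τ s t +
      (siteOp t (center τ (weightMul a (ρ - σ))) + siteOp s (center ρ (weightMul a (τ - σ)))) +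
      weightedPairing a (ρ - σ) (τ - σ) • 1 := by
  have h1 : siteOp t (center τ (weightMul a (ρ - σ))) =
      ∑ α, weightMul a (ρ - σ) α.2 α.1 • siteOp t (center τ (swapUnit α)) := by
    nth_rw 1 [← sum_smul_swapUnit]
    simp only [map_sum, map_smul]
  have h2 : siteOp s (center ρ (weightMul a (τ - σ))) =
      ∑ α : Fin d × Fin d, (τ - σ) α.1 α.2 • siteOp s (center ρ (weightedUnit a α)) := by
    nth_rw 1 [← sum_smul_weightedUnit]
    simp only [map_sum, map_smul]
  rw [h1, h2, weightedPairing, Finset.sum_smul, pairOp, pairOp, ← Finset.sum_add_distrib,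
    ← Finset.sum_add_distrib, ← Finset.sum_add_distrib]
  refine Finset.sum_congr rfl fun α _ => ?_
  rw [center_eq_add ρ σ, center_eq_add τ σ, map_add, map_add, map_smul, map_smul, siteOp_one,
    siteOp_one, trace_mul_weightedUnit, trace_mul_swapUnit]
  simp only [add_mul, mul_add, Matrix.smul_mul, Matrix.mul_smul, one_mul, mul_one, smul_smul]
  rw [mul_comm ((τ - σ) α.1 α.2)]
  abel

/-- Summing the decomposition over pairs, the pairing over s < t is half of the full double sum
without its diagonal, and the linear part at site t collects the deviations of all other sites. -/
theorem chiObservable_sub_eq (a : Fin d → ℝ) {σ : Matrix (Fin d) (Fin d) ℂ}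
    (hσ : σ.IsHermitian) {ρ : Fin T → Matrix (Fin d) (Fin d) ℂ} (hρ : ∀ t, (ρ t).IsHermitian) :
    chiObservable T a σ -
        (((weightedSq a (∑ t, (ρ t - σ)) - ∑ t, weightedSq a (ρ t - σ)) / 2 : ℝ) : ℂ) • 1 =
      ∑ p ∈ ltPairs T, pairOp a (ρ p.1) (ρ p.2) p.1 p.2 +
        ∑ t, siteOp t (center (ρ t) (weightMul a (∑ s, (ρ s - σ) - (ρ t - σ)))) := by
  have hpair : ∑ p ∈ ltPairs T, weightedPairing a (ρ p.1 - σ) (ρ p.2 - σ) =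
      (((weightedSq a (∑ t, (ρ t - σ)) - ∑ t, weightedSq a (ρ t - σ)) / 2 : ℝ) : ℂ) := by
    have h := sum_ltPairs_add_swap fun s t => weightedPairing a (ρ s - σ) (ρ t - σ)
    have hH : ∀ t, (ρ t - σ).IsHermitian := fun t => (hρ t).sub hσ
    have hS : (∑ t, (ρ t - σ)).IsHermitian := by
      rw [Matrix.IsHermitian, Matrix.conjTranspose_sum]
      exact Finset.sum_congr rfl fun t _ => hH t
    rw [sum_sum_weightedPairing a fun t => ρ t - σ, weightedPairing_self a hS] at h
    have h2 : ∑ p ∈ ltPairs T, (weightedPairing a (ρ p.1 - σ) (ρ p.2 - σ) +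
        weightedPairing a (ρ p.2 - σ) (ρ p.1 - σ)) =
        2 * ∑ p ∈ ltPairs T, weightedPairing a (ρ p.1 - σ) (ρ p.2 - σ) := by
      rw [Finset.mul_sum]
      refine Finset.sum_congr rfl fun p _ => ?_
      rw [weightedPairing_comm a (ρ p.2 - σ), two_mul]
    rw [h2] at h
    simp only [weightedPairing_self a (hH _)] at h
    push_cast
    rw [eq_div_iff two_ne_zero, mul_comm, h]
  have hlin := sum_ltPairs_add_swap fun s t => siteOp t (center (ρ t) (weightMul a (ρ s - σ)))
  have hlin2 : ∑ t, siteOp t (center (ρ t) (weightMul a (∑ s, (ρ s - σ) - (ρ t - σ)))) =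
      ∑ s, ∑ t, siteOp t (center (ρ t) (weightMul a (ρ s - σ))) -
        ∑ t, siteOp t (center (ρ t) (weightMul a (ρ t - σ))) := by
    rw [Finset.sum_comm, ← Finset.sum_sub_distrib]
    refine Finset.sum_congr rfl fun t _ => ?_
    simp only [map_sub, map_sum]
  rw [hlin2, ← hlin, ← hpair, chiObservable, Finset.sum_smul, sub_eq_iff_eq_add,
    ← Finset.sum_add_distrib, ← Finset.sum_add_distrib]
  exact Finset.sum_congr rfl fun p _ => pairOp_eq_add p.1 p.2 a σ _ _

/-! ### Second moments of the quadratic and linear parts -/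

theorem conjTranspose_pairOp {s t : Fin T} (hst : s ≠ t) (a : Fin d → ℝ)
    (ρ τ : Matrix (Fin d) (Fin d) ℂ) :
    (pairOp a ρ τ s t)ᴴ = ∑ α, siteOp s (center ρ (weightedUnit a α))ᴴ *
      siteOp t (center τ (swapUnit α))ᴴ := by
  rw [pairOp, Matrix.conjTranspose_sum]
  refine Finset.sum_congr rfl fun α _ => ?_
  rw [Matrix.conjTranspose_mul, conjTranspose_siteOp, conjTranspose_siteOp,
    siteOp_mul_comm hst.symm]

/-- Products of matrix units vanish unless α = β, so only diagonal entries of the two states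
survive. -/
theorem sum_trace_weightedUnit_swapUnit (a : Fin d → ℝ) (ρ τ : Matrix (Fin d) (Fin d) ℂ) :
    (∑ α, ∑ β, (ρ * ((weightedUnit a α)ᴴ * weightedUnit a β)).trace *
      (τ * ((swapUnit α)ᴴ * swapUnit β)).trace) =
      ∑ i, ∑ j, (weight a i j : ℂ) ^ 2 * (ρ j j * τ i i) := by
  rw [Fintype.sum_prod_type]
  refine Finset.sum_congr rfl fun i _ => Finset.sum_congr rfl fun j _ => ?_
  rw [Fintype.sum_eq_single (i, j)]
  · rw [conjTranspose_weightedUnit, conjTranspose_swapUnit, ← mul_assoc, trace_mul_weightedUnit,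
      ← mul_assoc, trace_mul_swapUnit, weightMul_apply]
    simp only [weightedUnit, swapUnit, Prod.swap, Matrix.mul_smul, Matrix.smul_apply, smul_eq_mul,
      Matrix.mul_single_apply_same, mul_one, weight_comm a j i]
    ring
  · rintro ⟨k, l⟩ hne
    rw [conjTranspose_weightedUnit, conjTranspose_swapUnit]
    simp only [weightedUnit, swapUnit, Prod.swap]
    by_cases hk : i = k
    · have hl : j ≠ l := fun h => hne (by rw [hk, h])
      rw [Matrix.single_mul_single_of_ne (h := hl)]
      simp
    · rw [Matrix.smul_mul, Matrix.mul_smul (single j i 1), Matrix.single_mul_single_of_ne (h := hk)]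
      simp

variable {ρ : Fin T → Matrix (Fin d) (Fin d) ℂ} (hρ : ∀ t, IsState (ρ t)) {a : Fin d → ℝ}
  (ha : ∀ i, 0 < a i)
include hρ

/-- Some site belongs to just one of the pairs, and there the factor has mean zero. -/
theorem trace_pairOp_mul_pairOp_of_ne (a : Fin d → ℝ) {p p' : Fin T × Fin T}
    (hp : p ∈ ltPairs T) (hp' : p' ∈ ltPairs T) (hne : p ≠ p') :
    (productState ρ * ((pairOp a (ρ p.1) (ρ p.2) p.1 p.2)ᴴ *
      pairOp a (ρ p'.1) (ρ p'.2) p'.1 p'.2)).trace = 0 := by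
  have hlt := (Finset.mem_filter.1 hp).2
  have hlt' := (Finset.mem_filter.1 hp').2
  rw [conjTranspose_pairOp hlt.ne, pairOp, Finset.sum_mul_sum, Finset.mul_sum, Matrix.trace_sum]
  refine Finset.sum_eq_zero fun α _ => ?_
  rw [Finset.mul_sum, Matrix.trace_sum]
  refine Finset.sum_eq_zero fun β _ => ?_
  refine trace_pair_mul_pair_of_ne hlt hlt' hne _ _ ?_ ?_
  · rw [conjTranspose_center (hρ _).posSemidef.isHermitian,
      trace_mul_center (hρ _).trace_eq_one]
  · rw [conjTranspose_center (hρ _).posSemidef.isHermitian,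
      trace_mul_center (hρ _).trace_eq_one]

include ha

/-- Dropping the centering only increases the second moment; then the bound 1/(aᵢaⱼ) on the squared
weight makes the double sum factor. -/
theorem trace_pairOp_mul_self_le {p : Fin T × Fin T} (hp : p ∈ ltPairs T) :
    (productState ρ * ((pairOp a (ρ p.1) (ρ p.2) p.1 p.2)ᴴ *
      pairOp a (ρ p.1) (ρ p.2) p.1 p.2)).trace.re ≤
      (∑ i, (ρ p.1 i i).re / a i) * ∑ i, (ρ p.2 i i).re / a i := by
  have hlt := (Finset.mem_filter.1 hp).2
  have h : (productState ρ * ((pairOp a (ρ p.1) (ρ p.2) p.1 p.2)ᴴ *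
      pairOp a (ρ p.1) (ρ p.2) p.1 p.2)).trace =
      ∑ α, ∑ β, (ρ p.1 * ((center (ρ p.1) (weightedUnit a α))ᴴ *
        center (ρ p.1) (weightedUnit a β))).trace *
        (ρ p.2 * ((center (ρ p.2) (swapUnit α))ᴴ * center (ρ p.2) (swapUnit β))).trace := by
    rw [conjTranspose_pairOp hlt.ne, pairOp, Finset.sum_mul_sum, Finset.mul_sum, Matrix.trace_sum]
    refine Finset.sum_congr rfl fun α _ => ?_
    rw [Finset.mul_sum, Matrix.trace_sum]
    exact Finset.sum_congr rfl fun β _ =>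
      trace_pair_mul_pair (fun t => (hρ t).trace_eq_one) hlt.ne _ _ _ _
  rw [h]
  refine (sum_trace_center_center_le (hρ _) (hρ _) _ _).trans ?_
  rw [sum_trace_weightedUnit_swapUnit, Finset.sum_mul_sum, Finset.sum_comm, Complex.re_sum]
  refine Finset.sum_le_sum fun i _ => ?_
  rw [Complex.re_sum]
  refine Finset.sum_le_sum fun j _ => ?_
  have him : ∀ t k, (ρ t k k).im = 0 := fun t k =>
    (Complex.le_def.1 ((hρ t).posSemidef.diag_nonneg (i := k))).2.symm
  rw [← Complex.ofReal_pow, Complex.re_ofReal_mul, Complex.mul_re, him, zero_mul, sub_zero]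
  have h1 := mul_nonneg (diag_re_nonneg (hρ p.1).posSemidef i)
    (diag_re_nonneg (hρ p.2).posSemidef j)
  refine (mul_le_mul_of_nonneg_right (weight_sq_le ha j i) h1).trans (le_of_eq ?_)
  have := (ha i).ne'
  have := (ha j).ne'
  field_simp

/-- The quadratic part of the observable has small second moment. -/
theorem trace_sum_pairOp_le :
    (productState ρ * ((∑ p ∈ ltPairs T, pairOp a (ρ p.1) (ρ p.2) p.1 p.2)ᴴ *
      ∑ p ∈ ltPairs T, pairOp a (ρ p.1) (ρ p.2) p.1 p.2)).trace.re ≤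
      (∑ t, ∑ i, (ρ t i i).re / a i) ^ 2 / 2 := by
  have hx : ∀ t, 0 ≤ ∑ i, (ρ t i i).re / a i := fun t => Finset.sum_nonneg fun i _ =>
    div_nonneg (diag_re_nonneg (hρ t).posSemidef i) (ha i).le
  rw [Matrix.conjTranspose_sum, Finset.sum_mul_sum, Finset.mul_sum, Matrix.trace_sum,
    Complex.re_sum]
  have h1 : ∀ p ∈ ltPairs T, (productState ρ * ∑ p' ∈ ltPairs T,
      (pairOp a (ρ p.1) (ρ p.2) p.1 p.2)ᴴ * pairOp a (ρ p'.1) (ρ p'.2) p'.1 p'.2).trace.re ≤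
      (∑ i, (ρ p.1 i i).re / a i) * ∑ i, (ρ p.2 i i).re / a i := by
    intro p hp
    rw [Finset.mul_sum, Matrix.trace_sum, Finset.sum_eq_single p]
    · exact trace_pairOp_mul_self_le hρ ha hp
    · exact fun p' hp' hne => trace_pairOp_mul_pairOp_of_ne hρ a hp hp' hne.symm
    · exact fun h => absurd hp h
  refine (Finset.sum_le_sum h1).trans ?_
  have h2 := sum_ltPairs_add_swap fun s t : Fin T =>
    (∑ i, (ρ s i i).re / a i) * ∑ i, (ρ t i i).re / a i
  simp only [mul_comm (∑ i, (ρ (Prod.snd _) i i).re / a i), ← two_mul, ← Finset.mul_sum] at h2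
  rw [← Finset.sum_mul, ← pow_two] at h2
  have h3 : 0 ≤ ∑ t, (∑ i, (ρ t i i).re / a i) * ∑ i, (ρ t i i).re / a i :=
    Finset.sum_nonneg fun t _ => mul_nonneg (hx t) (hx t)
  linarith

/-- The second moment of the linear part of the observable. -/
theorem trace_sum_siteOp_le {X : Fin T → Matrix (Fin d) (Fin d) ℂ} (hX : ∀ t, (X t).IsHermitian) :
    (productState ρ * ((∑ t, siteOp t (center (ρ t) (weightMul a (X t))))ᴴ *
      ∑ t, siteOp t (center (ρ t) (weightMul a (X t))))).trace.re ≤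
      ∑ t, (∑ i, (ρ t i i).re / a i) * weightedSq a (X t) := by
  rw [Matrix.conjTranspose_sum, Finset.sum_mul_sum, Finset.mul_sum, Matrix.trace_sum,
    Complex.re_sum]
  refine Finset.sum_le_sum fun t _ => ?_
  rw [Finset.mul_sum, Matrix.trace_sum, Finset.sum_eq_single t]
  · rw [conjTranspose_siteOp, trace_siteOp_mul_siteOp (fun t => (hρ t).trace_eq_one),
      trace_center_mul_center (hρ t), ← sum_norm_weightMul_sq ha (hX t), Complex.sub_re]
    refine (sub_le_self _ ?_).trans (trace_mul_conjTranspose_mul_self_le (hρ t).posSemidef ha _)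
    exact (Complex.le_def.1 (star_mul_self_nonneg _)).1
  · intro s _ hs
    rw [conjTranspose_siteOp, trace_siteOp_mul_siteOp_of_ne hs.symm]
    rw [conjTranspose_center (hρ _).posSemidef.isHermitian,
      trace_mul_center (hρ _).trace_eq_one]
  · simp

/-- Bias and variance of the observable, in terms of the smoothed `χ²`-divergence of the average
state and of the quantities `∑ i, ρₜ i i / aᵢ`. -/
theorem chiObservable_moments {q : Fin d → ℝ} (hq : ∀ i, 0 ≤ q i) (hqa : ∀ i, q i ≤ a i)
    (hq1 : ∑ i, q i = 1) {χ X : ℝ} {σ : Matrix (Fin d) (Fin d) ℂ}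
    (hσ : σ = Matrix.diagonal fun i => (q i : ℂ))
    (hχ : weightedSq a (∑ t, (ρ t - σ)) = T ^ 2 * χ)
    (hX : ∑ t, ∑ i, (ρ t i i).re / a i = X) :
    ∃ m : ℝ, m ≤ T ^ 2 * χ / 2 ∧ T ^ 2 * χ / 2 - X - T ≤ m ∧
      (productState ρ * ((chiObservable T a σ - (m : ℂ) • 1)ᴴ *
        (chiObservable T a σ - (m : ℂ) • 1))).trace.re ≤
        9 * X ^ 2 + 4 * T ^ 2 * χ * X + 8 * X := by
  have hσH : σ.IsHermitian := by
    rw [hσ, Matrix.isHermitian_diagonal_iff]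
    intro i
    simp [isSelfAdjoint_iff]
  have hx : ∀ t, 0 ≤ ∑ i, (ρ t i i).re / a i := fun t => Finset.sum_nonneg fun i _ =>
    div_nonneg (diag_re_nonneg (hρ t).posSemidef i) (ha i).le
  have hβ : ∀ t, weightedSq a (ρ t - σ) ≤ 2 * (∑ i, (ρ t i i).re / a i) + 2 := fun t => by
    have h1 := weightedSq_sub_le ha (ρ t) σ
    have h2 := weightedSq_le_of_isState ha (hρ t)
    have h3 := weightedSq_diagonal_le ha hq hqa hq1
    rw [← hσ] at h3
    linarith
  have hβ0 : ∀ t, 0 ≤ weightedSq a (ρ t - σ) := fun t => weightedSq_nonneg ha _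
  have hβsum : ∑ t, weightedSq a (ρ t - σ) ≤ 2 * X + 2 * T := by
    refine (Finset.sum_le_sum fun t _ => hβ t).trans (le_of_eq ?_)
    rw [Finset.sum_add_distrib, ← Finset.mul_sum, hX]
    simp [mul_comm]
  have hβsum0 : 0 ≤ ∑ t, weightedSq a (ρ t - σ) := Finset.sum_nonneg fun t _ => hβ0 t
  -- The exact mean: half of T²χ minus the diagonal sum, which lies between 0 and 2X + 2T.
  refine ⟨(weightedSq a (∑ t, (ρ t - σ)) - ∑ t, weightedSq a (ρ t - σ)) / 2, by linarith,
    by linarith, ?_⟩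
  rw [chiObservable_sub_eq a hσH fun t => (hρ t).posSemidef.isHermitian]
  -- Twice X²/2 from the quadratic part plus twice 2T²χX + 4X² + 4X from the linear part gives the
  -- stated bound.
  refine (trace_conjTranspose_mul_self_add_le
    (posSemidef_productState fun t => (hρ t).posSemidef) _ _).trans ?_
  have hQ := trace_sum_pairOp_le hρ ha
  have hS : (∑ t, (ρ t - σ)).IsHermitian := by
    rw [Matrix.IsHermitian, Matrix.conjTranspose_sum]
    exact Finset.sum_congr rfl fun t _ => (hρ t).posSemidef.isHermitian.sub hσH
  have hL := trace_sum_siteOp_le hρ ha (X := fun t => ∑ s, (ρ s - σ) - (ρ t - σ)) fun t =>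
    hS.sub ((hρ t).posSemidef.isHermitian.sub hσH)
  rw [hX] at hQ
  have hL2 : ∑ t, (∑ i, (ρ t i i).re / a i) * weightedSq a (∑ s, (ρ s - σ) - (ρ t - σ)) ≤
      2 * T ^ 2 * χ * X + 4 * X ^ 2 + 4 * X := by
    have h1 : ∀ t, (∑ i, (ρ t i i).re / a i) * weightedSq a (∑ s, (ρ s - σ) - (ρ t - σ)) ≤
        (2 * T ^ 2 * χ + 4) * (∑ i, (ρ t i i).re / a i) + 4 * (∑ i, (ρ t i i).re / a i) ^ 2 := by
      intro t
      have h2 := weightedSq_sub_le ha (∑ s, (ρ s - σ)) (ρ t - σ)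
      rw [hχ] at h2
      have h3 := mul_le_mul_of_nonneg_left (h2.trans (add_le_add_right
        (mul_le_mul_of_nonneg_left (hβ t) two_pos.le) _)) (hx t)
      linarith
    refine (Finset.sum_le_sum fun t _ => h1 t).trans ?_
    rw [Finset.sum_add_distrib, ← Finset.mul_sum, ← Finset.mul_sum, hX]
    have h4 : ∑ t, (∑ i, (ρ t i i).re / a i) ^ 2 ≤ X ^ 2 := by
      rw [← hX]
      exact Finset.sum_sq_le_sq_sum_of_nonneg fun t _ => hx t
    linarith
  linarith

end QuantumTesting

end

noncomputable section
namespace QuantumTesting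
open Matrix
open scoped ComplexOrder MatrixOrder

/-! ### The Bures distance is controlled by the smoothed divergence -/

section Fidelity
variable {n : Type*} [Fintype n] [DecidableEq n]

omit [DecidableEq n] in
theorem trace_conjTranspose_mul_self_add_le_of_pos {η : ℝ} (hη : 0 < η) (A B : Matrix n n ℂ) :
    ((A + B)ᴴ * (A + B)).trace.re ≤
      (1 + η) * (Aᴴ * A).trace.re + (1 + η⁻¹) * (Bᴴ * B).trace.re := by
  simp only [trace_conjTranspose_mul_self_re, Finset.mul_sum, ← Finset.sum_add_distrib]
  refine Finset.sum_le_sum fun i _ => Finset.sum_le_sum fun j _ => ?_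
  have h1 : ‖(A + B) i j‖ ≤ ‖A i j‖ + ‖B i j‖ := norm_add_le _ _
  have h2 := pow_le_pow_left₀ (norm_nonneg _) h1 2
  have h3 : 0 ≤ η⁻¹ * (η * ‖A i j‖ - ‖B i j‖) ^ 2 := by positivity
  have h4 : η⁻¹ * (η * ‖A i j‖ - ‖B i j‖) ^ 2 =
      η * ‖A i j‖ ^ 2 - 2 * ‖A i j‖ * ‖B i j‖ + η⁻¹ * ‖B i j‖ ^ 2 := by
    field_simp
    ring
  nlinarith

/-- In an eigenbasis W of |A| with eigenvalues sᵢ, the columns of A W have norm sᵢ and the rows of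
Wᴴ V are unit vectors, so Cauchy–Schwarz bounds each diagonal entry of (Wᴴ V)(A W) by sᵢ. -/
theorem trace_unitary_mul_re_le_traceNorm (V A : Matrix n n ℂ) (hV : V * Vᴴ = 1) :
    (V * A).trace.re ≤ traceNorm A := by
  have hP : (CFC.abs A).PosSemidef := Matrix.nonneg_iff_posSemidef.1 (CFC.abs_nonneg A)
  have hPP : CFC.abs A * CFC.abs A = Aᴴ * A := CFC.abs_mul_abs A
  rw [traceNorm]
  set P := CFC.abs A
  set W : Matrix n n ℂ := hP.isHermitian.eigenvectorUnitary.1 with hW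
  set s := hP.isHermitian.eigenvalues with hs
  have hWW : W * Wᴴ = 1 := Matrix.mem_unitaryGroup_iff.1 hP.isHermitian.eigenvectorUnitary.2
  have hWW' : Wᴴ * W = 1 := Matrix.mem_unitaryGroup_iff'.1 hP.isHermitian.eigenvectorUnitary.2
  have hsp : P = W * Matrix.diagonal (fun i => (s i : ℂ)) * Wᴴ := by
    have := hP.isHermitian.spectral_theorem
    rw [Unitary.conjStarAlgAut_apply] at this
    exact this
  have hs0 : ∀ i, 0 ≤ s i := hP.eigenvalues_nonneg
  have htr : P.trace.re = ∑ i, s i := by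
    rw [hsp, Matrix.trace_mul_comm, ← mul_assoc, hWW', one_mul, Matrix.trace_diagonal]
    simp
  have h1 : (V * A).trace = ((Wᴴ * V) * (A * W)).trace := by
    rw [mul_assoc, Matrix.trace_mul_comm Wᴴ, ← mul_assoc V, mul_assoc (V * A), hWW, mul_one]
  have h2 : (A * W)ᴴ * (A * W) = Matrix.diagonal fun i => ((s i ^ 2 : ℝ) : ℂ) := by
    calc (A * W)ᴴ * (A * W) = Wᴴ * (Aᴴ * A) * W := by
          rw [Matrix.conjTranspose_mul]; simp only [mul_assoc]
      _ = (Wᴴ * W) * Matrix.diagonal (fun i => (s i : ℂ)) * (Wᴴ * W) *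
          Matrix.diagonal (fun i => (s i : ℂ)) * (Wᴴ * W) := by
          rw [← hPP, hsp]; simp only [mul_assoc]
      _ = _ := by
          rw [hWW', one_mul, mul_one, mul_one, Matrix.diagonal_mul_diagonal]
          simp only [pow_two, Complex.ofReal_mul]
  have h3 : (Wᴴ * V)ᴴᴴ * (Wᴴ * V)ᴴ = 1 := by
    rw [Matrix.conjTranspose_conjTranspose, Matrix.conjTranspose_mul,
      Matrix.conjTranspose_conjTranspose, mul_assoc, ← mul_assoc V, hV, one_mul, hWW']
  rw [h1, htr, Matrix.trace, Complex.re_sum]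
  refine Finset.sum_le_sum fun i _ => (Complex.re_le_norm _).trans ?_
  refine le_of_sq_le_sq ?_ (hs0 i)
  have h4 := norm_sum_mul_sq_le (a := fun _ => 1) (fun _ => one_pos)
    (fun l => (Wᴴ * V) i l) (fun l => (A * W) l i)
  have h5 := congrArg (fun M : Matrix n n ℂ => (M i i).re) h2
  have h6 := congrArg (fun M : Matrix n n ℂ => (M i i).re) h3
  simp only [diag_re_eq_sum] at h5 h6
  simp only [Matrix.conjTranspose_apply, norm_star, Matrix.one_apply_eq, Complex.one_re,
    Matrix.diagonal_apply_eq, Complex.ofReal_re] at h5 h6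
  simp only [one_mul, div_one, h5, h6] at h4
  exact h4

/-- The assumption 0 ≤ b covers the case where the outer square root would be taken of a negative
number, so that fidelity at most one need not be known. -/
theorem buresDist_sq_le {ρ σ : Matrix n n ℂ} {b : ℝ} (hb : 0 ≤ b)
    (h : 2 - 2 * traceNorm (CFC.sqrt ρ * CFC.sqrt σ) ≤ b) : buresDist ρ σ ^ 2 ≤ b := by
  rw [buresDist, fidelity, Real.sqrt_sq_eq_abs]
  rcases le_or_gt 0 (2 * (1 - |traceNorm (CFC.sqrt ρ * CFC.sqrt σ)|)) with h0 | h0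
  · rw [Real.sq_sqrt h0]
    have := le_abs_self (traceNorm (CFC.sqrt ρ * CFC.sqrt σ))
    linarith
  · rw [Real.sqrt_eq_zero_of_nonpos h0.le]
    simpa using hb

/-- The Bures distance is bounded by the Frobenius distance of purifications. -/
theorem buresDist_sq_le_of_unitary {ρ σ V : Matrix n n ℂ} (hρ : IsState ρ) (hσ : IsState σ)
    (hV : Vᴴ * V = 1) :
    buresDist ρ σ ^ 2 ≤
      ((CFC.sqrt ρ * V - CFC.sqrt σ)ᴴ * (CFC.sqrt ρ * V - CFC.sqrt σ)).trace.re := by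
  have hr : (CFC.sqrt ρ)ᴴ = CFC.sqrt ρ :=
    (Matrix.nonneg_iff_posSemidef.1 (CFC.sqrt_nonneg ρ)).isHermitian
  have hs : (CFC.sqrt σ)ᴴ = CFC.sqrt σ :=
    (Matrix.nonneg_iff_posSemidef.1 (CFC.sqrt_nonneg σ)).isHermitian
  have hrr : CFC.sqrt ρ * CFC.sqrt ρ = ρ :=
    CFC.sqrt_mul_sqrt_self ρ (Matrix.nonneg_iff_posSemidef.2 hρ.posSemidef)
  have hss : CFC.sqrt σ * CFC.sqrt σ = σ :=
    CFC.sqrt_mul_sqrt_self σ (Matrix.nonneg_iff_posSemidef.2 hσ.posSemidef)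
  have hV' : V * Vᴴ = 1 := mul_eq_one_comm.1 hV
  refine buresDist_sq_le ?_ ?_
  · rw [trace_conjTranspose_mul_self_re]
    positivity
  -- Expanding the squared norm leaves 2 − 2 Re tr(Vᴴ √ρ √σ), and the trace norm dominates this
  -- trace.
  have h1 := trace_unitary_mul_re_le_traceNorm Vᴴ (CFC.sqrt ρ * CFC.sqrt σ)
    (by rw [Matrix.conjTranspose_conjTranspose, hV])
  set r := CFC.sqrt ρ
  set s := CFC.sqrt σ
  have h2 : ((r * V - s)ᴴ * (r * V - s)).trace.re = 2 - 2 * (Vᴴ * (r * s)).trace.re := by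
    have e1 : (Vᴴ * (r * (r * V))).trace = 1 := by
      rw [← mul_assoc, Matrix.trace_mul_comm, mul_assoc, ← mul_assoc V, hV', one_mul, hrr, hρ.trace_eq_one]
    have e2 : (s * (r * V)).trace = star (Vᴴ * (r * s)).trace := by
      rw [← Matrix.trace_conjTranspose]
      simp only [Matrix.conjTranspose_mul, Matrix.conjTranspose_conjTranspose, hr, hs, mul_assoc]
    rw [Matrix.conjTranspose_sub, Matrix.conjTranspose_mul, hr, hs, sub_mul, mul_sub, mul_sub, hss]
    simp only [Matrix.trace_sub, e1, e2, hσ.trace_eq_one, Complex.sub_re, mul_assoc]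
    simp only [Complex.one_re, Complex.star_def, Complex.conj_re]
    ring
  rw [h2]
  linarith

/-- The square root of `ρ + δ` is close to that of `ρ`. -/
theorem exists_sqrt_add_smul_one {ρ : Matrix n n ℂ} (hρ : ρ.PosSemidef) {δ : ℝ} (hδ : 0 < δ) :
    ∃ R : Matrix n n ℂ, Rᴴ = R ∧ IsUnit R.det ∧ R * R = ρ + (δ : ℂ) • 1 ∧
      ((R - CFC.sqrt ρ)ᴴ * (R - CFC.sqrt ρ)).trace.re ≤ Fintype.card n * δ := by
  set W : Matrix n n ℂ := hρ.isHermitian.eigenvectorUnitary.1 with hW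
  set p := hρ.isHermitian.eigenvalues with hp
  have hWW : W * Wᴴ = 1 := Matrix.mem_unitaryGroup_iff.1 hρ.isHermitian.eigenvectorUnitary.2
  have hWW' : Wᴴ * W = 1 := Matrix.mem_unitaryGroup_iff'.1 hρ.isHermitian.eigenvectorUnitary.2
  have hsp : ρ = W * Matrix.diagonal (fun i => (p i : ℂ)) * Wᴴ := by
    have := hρ.isHermitian.spectral_theorem
    rw [Unitary.conjStarAlgAut_apply] at this
    exact this
  have hp0 : ∀ i, 0 ≤ p i := hρ.eigenvalues_nonneg
  let D : (n → ℝ) → Matrix n n ℂ := fun f => W * Matrix.diagonal (fun i => (f i : ℂ)) * Wᴴ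
  have hDmul : ∀ f g : n → ℝ, D f * D g = D (f * g) := by
    intro f g
    calc D f * D g = W * Matrix.diagonal (fun i => (f i : ℂ)) * (Wᴴ * W) *
          Matrix.diagonal (fun i => (g i : ℂ)) * Wᴴ := by simp only [D, mul_assoc]
      _ = _ := by
          rw [hWW', mul_one, mul_assoc W, Matrix.diagonal_mul_diagonal]
          simp only [D, Pi.mul_apply, Complex.ofReal_mul]
  have hDH : ∀ f, (D f)ᴴ = D f := by
    intro f
    simp only [D, Matrix.conjTranspose_mul, Matrix.conjTranspose_conjTranspose,
      Matrix.diagonal_conjTranspose, mul_assoc]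
    congr 3
    ext i
    simp
  have hDsub : ∀ f g : n → ℝ, D f - D g = D (f - g) := by
    intro f g
    simp only [D, ← sub_mul, ← mul_sub, Matrix.diagonal_sub, Pi.sub_apply, Complex.ofReal_sub]
  have hDadd : ρ + (δ : ℂ) • 1 = D (fun i => p i + δ) := by
    have h1 : (δ : ℂ) • (1 : Matrix n n ℂ) = D (fun _ => δ) := by
      rw [← hWW]
      simp only [D]
      rw [← Matrix.smul_mul]
      congr 1
      ext i j
      simp [mul_comm]
    rw [h1]
    nth_rw 1 [hsp]
    simp only [D, ← add_mul, ← mul_add, Matrix.diagonal_add, Complex.ofReal_add]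
  have hsqrt : CFC.sqrt ρ = D (fun i => √(p i)) := by
    refine CFC.sqrt_unique ?_ (Matrix.nonneg_iff_posSemidef.2 ?_)
    · rw [hDmul]
      have : (fun i => √(p i)) * (fun i => √(p i)) = p := funext fun i => Real.mul_self_sqrt (hp0 i)
      rw [this]
      exact hsp.symm
    · refine (Matrix.PosSemidef.diagonal fun i => ?_).mul_mul_conjTranspose_same W
      simp [Complex.zero_le_real, Real.sqrt_nonneg]
  refine ⟨D fun i => √(p i + δ), hDH _, ?_, ?_, ?_⟩
  · refine (Matrix.isUnit_iff_isUnit_det _).1 (IsUnit.of_mul_eq_one (D fun i => (√(p i + δ))⁻¹) ?_)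
    rw [hDmul]
    have : (fun i => √(p i + δ)) * (fun i => (√(p i + δ))⁻¹) = fun _ => 1 := funext fun i =>
      mul_inv_cancel₀ (Real.sqrt_pos.2 (by linarith [hp0 i])).ne'
    rw [this]
    simp only [D, Complex.ofReal_one, Matrix.diagonal_one, mul_one, hWW]
  · rw [hDmul, hDadd]
    congr 1
    exact funext fun i => Real.mul_self_sqrt (by linarith [hp0 i])
  · rw [hsqrt, hDsub, hDH, hDmul]
    simp only [D]
    rw [Matrix.trace_mul_comm, ← mul_assoc, hWW', one_mul, Matrix.trace_diagonal, Complex.re_sum]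
    simp only [Complex.ofReal_re, Pi.mul_apply, Pi.sub_apply]
    -- Each eigenvalue contributes (√(p+δ) − √p)² ≤ δ.
    refine (Finset.sum_le_card_nsmul _ _ δ fun i _ => ?_).trans (le_of_eq ?_)
    · have h1 := Real.sqrt_nonneg (p i)
      have h2 := Real.mul_self_sqrt (hp0 i)
      have h3 := Real.mul_self_sqrt (show 0 ≤ p i + δ by linarith [hp0 i])
      have h4 := Real.sqrt_le_sqrt (show p i ≤ p i + δ by linarith)
      nlinarith
    · simp

/-- The weighted norm is the Legendre dual of Y ↦ tr(Y diag(a) Y). Symmetrizing aⱼ to (aᵢ + aⱼ)/2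
and completing the square in each entry gives the inequality. -/
theorem two_trace_mul_sub_le_of_diagonal {a : n → ℝ} (ha : ∀ i, 0 < a i) (Δ : Matrix n n ℂ)
    {Y : Matrix n n ℂ} (hY : Yᴴ = Y) :
    2 * (Δ * Y).trace.re - (Y * Matrix.diagonal (fun i => (a i : ℂ)) * Y).trace.re ≤
      weightedSq a Δ := by
  have hn : ∀ i j, ‖Y i j‖ = ‖Y j i‖ := fun i j => by
    nth_rw 1 [← hY]
    rw [Matrix.conjTranspose_apply, norm_star]
  have h1 : (Y * Matrix.diagonal (fun i => (a i : ℂ)) * Y).trace.re =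
      ∑ i, ∑ j, a j * ‖Y i j‖ ^ 2 := by
    rw [Matrix.trace, Complex.re_sum]
    refine Finset.sum_congr rfl fun i _ => ?_
    rw [Matrix.diag_apply, Matrix.mul_apply, Complex.re_sum]
    refine Finset.sum_congr rfl fun j _ => ?_
    have : Y j i = star (Y i j) := by
      nth_rw 1 [← hY]
      rw [Matrix.conjTranspose_apply]
    rw [Matrix.mul_diagonal, this, mul_right_comm, Complex.star_def, Complex.mul_conj',
      mul_comm, ← Complex.ofReal_pow, ← Complex.ofReal_mul, Complex.ofReal_re]
  have h2 : ∑ i, ∑ j, a j * ‖Y i j‖ ^ 2 = ∑ i, ∑ j, (a i + a j) / 2 * ‖Y i j‖ ^ 2 := by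
    have h3 : ∑ i, ∑ j, a j * ‖Y i j‖ ^ 2 = ∑ i, ∑ j, a i * ‖Y i j‖ ^ 2 := by
      rw [Finset.sum_comm]
      exact Finset.sum_congr rfl fun i _ => Finset.sum_congr rfl fun j _ => by rw [hn]
    simp only [add_div, add_mul, Finset.sum_add_distrib, div_mul_eq_mul_div, ← Finset.sum_div]
    linarith
  rw [h1, h2, Matrix.trace, Complex.re_sum, weightedSq, Finset.mul_sum, ← Finset.sum_sub_distrib]
  refine Finset.sum_le_sum fun i _ => ?_
  rw [Matrix.diag_apply, Matrix.mul_apply, Complex.re_sum, Finset.mul_sum,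
    ← Finset.sum_sub_distrib]
  refine Finset.sum_le_sum fun j _ => ?_
  have h4 : (Δ i j * Y j i).re ≤ ‖Δ i j‖ * ‖Y i j‖ := by
    rw [hn i j, ← norm_mul]
    exact Complex.re_le_norm _
  have hs := add_pos (ha i) (ha j)
  have h5 : 0 ≤ (2 * ‖Δ i j‖ - (a i + a j) * ‖Y i j‖) ^ 2 / (2 * (a i + a j)) := by positivity
  have h6 : (2 * ‖Δ i j‖ - (a i + a j) * ‖Y i j‖) ^ 2 / (2 * (a i + a j)) =
      weight a i j * ‖Δ i j‖ ^ 2 - 2 * (‖Δ i j‖ * ‖Y i j‖) + (a i + a j) / 2 * ‖Y i j‖ ^ 2 := by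
    rw [weight]
    have := hs.ne'
    field_simp
    ring
  linarith

theorem two_trace_mul_sub_le {a : n → ℝ} (ha : ∀ i, 0 < a i) {U : Matrix n n ℂ}
    (hU : U * Uᴴ = 1) (Δ : Matrix n n ℂ) {Y : Matrix n n ℂ} (hY : Yᴴ = Y) :
    2 * (Δ * Y).trace.re - (Y * (U * Matrix.diagonal (fun i => (a i : ℂ)) * Uᴴ) * Y).trace.re ≤
      weightedSq a (Uᴴ * Δ * U) := by
  have h := two_trace_mul_sub_le_of_diagonal ha (Uᴴ * Δ * U) (Y := Uᴴ * Y * U) (by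
    simp only [Matrix.conjTranspose_mul, Matrix.conjTranspose_conjTranspose, hY, mul_assoc])
  have h1 : (Uᴴ * Δ * U * (Uᴴ * Y * U)).trace = (Δ * Y).trace := by
    calc (Uᴴ * Δ * U * (Uᴴ * Y * U)).trace = (Uᴴ * (Δ * (U * Uᴴ) * Y * U)).trace := by
          simp only [mul_assoc]
      _ = _ := by rw [hU, mul_one, Matrix.trace_mul_comm, mul_assoc, hU, mul_one]
  have h2 : (Uᴴ * Y * U * Matrix.diagonal (fun i => (a i : ℂ)) * (Uᴴ * Y * U)).trace =
      (Y * (U * Matrix.diagonal (fun i => (a i : ℂ)) * Uᴴ) * Y).trace := by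
    calc (Uᴴ * Y * U * Matrix.diagonal (fun i => (a i : ℂ)) * (Uᴴ * Y * U)).trace
        = (Uᴴ * (Y * (U * Matrix.diagonal (fun i => (a i : ℂ)) * Uᴴ) * Y * U)).trace := by
          simp only [mul_assoc]
      _ = _ := by rw [Matrix.trace_mul_comm, mul_assoc, hU, mul_one]
  rwa [h1, h2] at h

/-- Invertible operators have purifications whose squared Frobenius distance is at most their
Bures `χ²`-divergence. -/
theorem exists_unitary_trace_le_weightedSq {a : n → ℝ} (ha : ∀ i, 0 < a i) {U R S : Matrix n n ℂ}
    (hU : U * Uᴴ = 1) (hR : Rᴴ = R) (hS : Sᴴ = S) (hRu : IsUnit R.det) (hSu : IsUnit S.det)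
    (hSS : S * S = U * Matrix.diagonal (fun i => (a i : ℂ)) * Uᴴ) :
    ∃ V : Matrix n n ℂ, Vᴴ * V = 1 ∧
      ((R * V - S)ᴴ * (R * V - S)).trace.re ≤ weightedSq a (Uᴴ * (R * R - S * S) * U) := by
  have hQ : (S * (R * R) * S).PosSemidef := by
    have : S * (R * R) * S = (R * S)ᴴ * (R * S) := by
      rw [Matrix.conjTranspose_mul, hR, hS]
      simp only [mul_assoc]
    rw [this]
    exact Matrix.posSemidef_conjTranspose_mul_self _
  set P := CFC.sqrt (S * (R * R) * S)
  have hP : P.PosSemidef := Matrix.nonneg_iff_posSemidef.1 (CFC.sqrt_nonneg _)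
  have hPP : P * P = S * (R * R) * S :=
    CFC.sqrt_mul_sqrt_self _ (Matrix.nonneg_iff_posSemidef.2 hQ)
  have hSi : (S⁻¹)ᴴ = S⁻¹ := by rw [Matrix.conjTranspose_nonsing_inv, hS]
  have hRi : (R⁻¹)ᴴ = R⁻¹ := by rw [Matrix.conjTranspose_nonsing_inv, hR]
  have hS1 := Matrix.mul_nonsing_inv S hSu
  have hS2 := Matrix.nonsing_inv_mul S hSu
  have hR1 := Matrix.mul_nonsing_inv R hRu
  have hR2 := Matrix.nonsing_inv_mul R hRu
  -- The matrix geometric mean of S⁻² and R²: the positive solution of M S² M = R².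
  set M := S⁻¹ * P * S⁻¹ with hM
  have hMpos : M.PosSemidef := by
    have := hP.mul_mul_conjTranspose_same S⁻¹
    rwa [hSi] at this
  have hMH : Mᴴ = M := hMpos.isHermitian
  have hMSM : M * (S * S) * M = R * R := by
    calc M * (S * S) * M = S⁻¹ * P * (S⁻¹ * S) * (S * S⁻¹) * P * S⁻¹ := by
          simp only [hM, mul_assoc]
      _ = S⁻¹ * (P * P) * S⁻¹ := by rw [hS1, hS2, mul_one, mul_one]; simp only [mul_assoc]
      _ = (S⁻¹ * S) * (R * R) * (S * S⁻¹) := by rw [hPP]; simp only [mul_assoc]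
      _ = _ := by rw [hS1, hS2, one_mul, mul_one]
  -- Chosen so that R V = M S; unitarity is the equation M S² M = R².
  refine ⟨R⁻¹ * M * S, mul_eq_one_comm.1 ?_, ?_⟩
  · calc R⁻¹ * M * S * (R⁻¹ * M * S)ᴴ = R⁻¹ * (M * (S * S) * M) * R⁻¹ := by
          simp only [Matrix.conjTranspose_mul, hS, hMH, hRi, mul_assoc]
      _ = (R⁻¹ * R) * (R * R⁻¹) := by rw [hMSM]; simp only [mul_assoc]
      _ = 1 := by rw [hR1, hR2, one_mul]
  have hRV : R * (R⁻¹ * M * S) - S = (M - 1) * S := by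
    rw [← mul_assoc, ← mul_assoc, hR1, one_mul, sub_mul, one_mul]
  have hYH : (M * M - 1)ᴴ = M * M - 1 := by
    rw [Matrix.conjTranspose_sub, Matrix.conjTranspose_mul, hMH, Matrix.conjTranspose_one]
  -- With Y = M² − 1 both tr((R² − S²)Y) and tr(Y S² Y) equal tr(S² Y²), so duality bounds this
  -- trace.
  have hdual := two_trace_mul_sub_le ha hU (R * R - S * S) hYH
  rw [← hSS] at hdual
  have e1 : ((R * R - S * S) * (M * M - 1)).trace =
      (S * S * ((M * M - 1) * (M * M - 1))).trace := by
    have : (M * (S * S) * M * (M * M - 1)).trace = (S * S * (M * (M * M - 1) * M)).trace := by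
      rw [mul_assoc M, mul_assoc M, Matrix.trace_mul_comm M]
      simp only [mul_assoc]
    rw [← hMSM, sub_mul, Matrix.trace_sub, this, ← Matrix.trace_sub, ← mul_sub]
    congr 2
    noncomm_ring
  have e2 : ((M * M - 1) * (S * S) * (M * M - 1)).trace =
      (S * S * ((M * M - 1) * (M * M - 1))).trace := by
    rw [mul_assoc, Matrix.trace_mul_comm, mul_assoc]
  rw [e1, e2] at hdual
  have e3 : ((R * (R⁻¹ * M * S) - S)ᴴ * (R * (R⁻¹ * M * S) - S)).trace =
      (S * S * ((M - 1) * (M - 1))).trace := by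
    rw [hRV, Matrix.conjTranspose_mul, Matrix.conjTranspose_sub, hMH, hS, Matrix.conjTranspose_one,
      Matrix.trace_mul_comm, mul_assoc, Matrix.trace_mul_comm]
    simp only [mul_assoc]
  -- This matrix is (M² − 1)² − (M − 1)², since (M + 1)² − 1 = M² + 2M.
  have hpos : ((M - 1) * (M * M + (2 : ℂ) • M) * (M - 1)ᴴ).PosSemidef := by
    refine Matrix.PosSemidef.mul_mul_conjTranspose_same (Matrix.PosSemidef.add ?_ ?_) _
    · nth_rw 1 [← hMH]
      exact Matrix.posSemidef_conjTranspose_mul_self M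
    · exact hMpos.smul (by norm_num)
  have hSSpos : (S * S).PosSemidef := by
    nth_rw 1 [← hS]
    exact Matrix.posSemidef_conjTranspose_mul_self S
  have hlast := trace_mul_re_nonneg hSSpos hpos
  have e4 : (M - 1) * (M * M + (2 : ℂ) • M) * (M - 1)ᴴ =
      (M * M - 1) * (M * M - 1) - (M - 1) * (M - 1) := by
    rw [Matrix.conjTranspose_sub, hMH, Matrix.conjTranspose_one, two_smul]
    noncomm_ring
  rw [e4, mul_sub, Matrix.trace_sub, Complex.sub_re] at hlast
  rw [e3]
  linarith

/-- The squared Bures distance is bounded by the smoothed Bures `χ²`-divergence, up to an error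
proportional to the smoothing parameter. -/
theorem buresDist_sq_le_weightedSq {ρ σ U : Matrix n n ℂ} (hρ : IsState ρ) (hσ : IsState σ)
    {q : n → ℝ} (hq : ∀ i, 0 ≤ q i) (hU : U * Uᴴ = 1)
    (hsp : σ = U * Matrix.diagonal (fun i => (q i : ℂ)) * Uᴴ) {δ η : ℝ} (hδ : 0 < δ)
    (hη : 0 < η) :
    buresDist ρ σ ^ 2 ≤ (1 + η) * weightedSq (fun i => q i + δ) (Uᴴ * (ρ - σ) * U) +
      (1 + η⁻¹) * (4 * (Fintype.card n * δ)) := by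
  obtain ⟨R, hR, hRu, hRR, hRd⟩ := exists_sqrt_add_smul_one hρ.posSemidef hδ
  obtain ⟨S, hS, hSu, hSS, hSd⟩ := exists_sqrt_add_smul_one hσ.posSemidef hδ
  have hSS' : S * S = U * Matrix.diagonal (fun i => ((q i + δ : ℝ) : ℂ)) * Uᴴ := by
    have h1 : (fun i => ((q i + δ : ℝ) : ℂ)) = fun i => (q i : ℂ) + (δ : ℂ) := by
      funext i
      push_cast
      rfl
    rw [hSS, h1, ← Matrix.diagonal_add, mul_add, add_mul, ← hsp, ← Matrix.smul_one_eq_diagonal,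
      Matrix.mul_smul, Matrix.smul_mul, mul_one, hU]
  obtain ⟨V, hV, hVd⟩ := exists_unitary_trace_le_weightedSq
    (fun i => add_pos_of_nonneg_of_pos (hq i) hδ) hU hR hS hRu hSu hSS'
  have hdiff : R * R - S * S = ρ - σ := by rw [hRR, hSS]; abel
  rw [hdiff] at hVd
  refine (buresDist_sq_le_of_unitary hρ hσ hV).trans ?_
  -- The bracket holds the two errors from smoothing the square roots, each of squared norm at most
  -- nδ for dimension n, hence at most 4nδ together.
  have hsplit : CFC.sqrt ρ * V - CFC.sqrt σ =
      (R * V - S) + ((S - CFC.sqrt σ) + (-(R - CFC.sqrt ρ)) * V) := by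
    noncomm_ring
  rw [hsplit]
  refine (trace_conjTranspose_mul_self_add_le_of_pos hη _ _).trans ?_
  have h1 := trace_conjTranspose_mul_self_add_le_of_pos one_pos (S - CFC.sqrt σ)
    ((-(R - CFC.sqrt ρ)) * V)
  have h2 : (((-(R - CFC.sqrt ρ)) * V)ᴴ * ((-(R - CFC.sqrt ρ)) * V)).trace =
      ((R - CFC.sqrt ρ)ᴴ * (R - CFC.sqrt ρ)).trace := by
    rw [Matrix.conjTranspose_mul, Matrix.conjTranspose_neg, mul_assoc, Matrix.trace_mul_comm]
    simp only [neg_mul, mul_neg, neg_neg, mul_assoc, mul_eq_one_comm.1 hV, mul_one]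
  rw [h2] at h1
  refine add_le_add (mul_le_mul_of_nonneg_left hVd (by positivity))
    (mul_le_mul_of_nonneg_left ?_ (by positivity))
  rw [inv_one] at h1
  linarith

end Fidelity
end QuantumTesting

end

noncomputable section
namespace QuantumTesting
open Matrix
open scoped ComplexOrder ENNReal

variable {d T : ℕ}

/-! ### Choice of constants and the test -/

theorem IsState.conj {n : Type*} [Fintype n] [DecidableEq n] {ρ U : Matrix n n ℂ}
    (hρ : IsState ρ) (hU : U * Uᴴ = 1) : IsState (Uᴴ * ρ * U) :=
  ⟨hρ.posSemidef.conjTranspose_mul_mul_same U, by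
    rw [mul_assoc, Matrix.trace_mul_comm, mul_assoc, hU, mul_one, hρ.trace_eq_one]⟩

theorem isState_avgState (hT : T ≠ 0) {ρ : Fin T → Matrix (Fin d) (Fin d) ℂ}
    (hρ : ∀ t, IsState (ρ t)) : IsState (avgState ρ) := by
  refine ⟨Matrix.PosSemidef.smul (Matrix.posSemidef_sum _ fun t _ => (hρ t).posSemidef) ?_, ?_⟩
  · simp
  · rw [avgState, Matrix.trace_smul, Matrix.trace_sum]
    simp [(hρ _).trace_eq_one, hT]

/-- A test may be preceded by a unitary. -/
theorem Test.exists_conj {n : Type*} [Fintype n] [DecidableEq n] (A : Test n) {W : Matrix n n ℂ}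
    (hW : W * Wᴴ = 1) : ∃ B : Test n, ∀ ϱ,
      B.acceptProb ϱ = A.acceptProb (Wᴴ * ϱ * W) ∧ B.rejectProb ϱ = A.rejectProb (Wᴴ * ϱ * W) := by
  have h1 : 1 - W * A.effect * Wᴴ = W * (1 - A.effect) * Wᴴ := by
    rw [mul_sub, sub_mul, mul_one, hW]
  have h2 : ∀ ϱ E : Matrix n n ℂ, (ϱ * (W * E * Wᴴ)).trace = (Wᴴ * ϱ * W * E).trace := by
    intro ϱ E
    rw [← mul_assoc, Matrix.trace_mul_comm]
    simp only [mul_assoc]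
  refine ⟨⟨W * A.effect * Wᴴ, A.effect_posSemidef.mul_mul_conjTranspose_same W, ?_⟩, fun ϱ => ⟨?_, ?_⟩⟩
  · rw [h1]
    exact A.compl_posSemidef.mul_mul_conjTranspose_same W
  · simp only [Test.acceptProb, h2]
  · simp only [Test.rejectProb, h1, h2]

/-- Enlarging the denominators decreases each term, including those with denominator zero. -/
theorem ofReal_weightedSq_le_diagChiSq {n : Type*} [Fintype n] {q : n → ℝ} (hq : ∀ i, 0 ≤ q i)
    {δ : ℝ} (hδ : 0 < δ) (Δ : Matrix n n ℂ) :
    ENNReal.ofReal (weightedSq (fun i => q i + δ) Δ) ≤ diagChiSq q Δ := by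
  have hw := fun i j => (weight_pos (fun i => add_pos_of_nonneg_of_pos (hq i) hδ) i j).le
  have h0 : ∀ i j, 0 ≤ weight (fun i => q i + δ) i j * ‖Δ i j‖ ^ 2 := fun i j =>
    mul_nonneg (hw i j) (sq_nonneg _)
  rw [weightedSq, ENNReal.ofReal_sum_of_nonneg fun i _ => Finset.sum_nonneg fun j _ => h0 i j,
    diagChiSq]
  refine Finset.sum_le_sum fun i _ => ?_
  rw [ENNReal.ofReal_sum_of_nonneg fun j _ => h0 i j]
  refine Finset.sum_le_sum fun j _ => ?_
  have hpos : 0 < (q i + δ) + (q j + δ) := by linarith [hq i, hq j]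
  rw [weight, div_mul_eq_mul_div, ENNReal.ofReal_div_of_pos hpos]
  exact ENNReal.div_le_div_left (ENNReal.ofReal_le_ofReal (by linarith)) _

/-- The part from q contributes at most d. For the rest, Re Δᵢᵢ ≤ |Δᵢᵢ|²/(2μ) + μ/2, and |Δᵢᵢ|²/(qᵢ
+ δ) is a diagonal term of the weighted norm. Only δ bounds the denominators from below, never the
least eigenvalue. -/
theorem sum_diag_div_le {q : Fin d → ℝ} (hq : ∀ i, 0 ≤ q i) {δ μ : ℝ} (hδ : 0 < δ) (hμ : 0 < μ)
    (Δ : Matrix (Fin d) (Fin d) ℂ) :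
    ∑ i, (q i + (Δ i i).re) / (q i + δ) ≤
      d + weightedSq (fun i => q i + δ) Δ / (2 * μ) + d * (μ / (2 * δ)) := by
  have ha : ∀ i, 0 < q i + δ := fun i => add_pos_of_nonneg_of_pos (hq i) hδ
  have h1 : ∑ i, ‖Δ i i‖ ^ 2 / (q i + δ) ≤ weightedSq (fun i => q i + δ) Δ := by
    refine Finset.sum_le_sum fun i _ => ?_
    refine le_trans (le_of_eq ?_) (Finset.single_le_sum
      (f := fun j => weight (fun i => q i + δ) i j * ‖Δ i j‖ ^ 2)
      (fun j _ => mul_nonneg (weight_pos ha i j).le (sq_nonneg _)) (Finset.mem_univ i))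
    have := (ha i).ne'
    simp only [weight]
    field_simp
    norm_num
  have h2 : ∀ i, (q i + (Δ i i).re) / (q i + δ) ≤
      1 + (‖Δ i i‖ ^ 2 / (q i + δ)) / (2 * μ) + μ / (2 * δ) := by
    intro i
    have h3 : (Δ i i).re ≤ ‖Δ i i‖ ^ 2 / (2 * μ) + μ / 2 := by
      have h4 := Complex.re_le_norm (Δ i i)
      have h5 : ‖Δ i i‖ ^ 2 / (2 * μ) + μ / 2 - ‖Δ i i‖ = (‖Δ i i‖ - μ) ^ 2 / (2 * μ) := by
        field_simp
        ring
      have h6 : 0 ≤ (‖Δ i i‖ - μ) ^ 2 / (2 * μ) := by positivity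
      linarith
    have h7 : μ / 2 / (q i + δ) ≤ μ / (2 * δ) := by
      rw [div_div]
      exact div_le_div_of_nonneg_left hμ.le (by positivity) (by linarith [hq i])
    calc (q i + (Δ i i).re) / (q i + δ)
        ≤ (q i + (‖Δ i i‖ ^ 2 / (2 * μ) + μ / 2)) / (q i + δ) :=
          div_le_div_of_nonneg_right (by linarith) (ha i).le
      _ = q i / (q i + δ) + (‖Δ i i‖ ^ 2 / (q i + δ)) / (2 * μ) + μ / 2 / (q i + δ) := by
          rw [add_div, add_div, div_right_comm (‖Δ i i‖ ^ 2)]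
          ring
      _ ≤ _ := by
          have h8 : q i / (q i + δ) ≤ 1 := (div_le_one (ha i)).2 (by linarith)
          linarith
  refine (Finset.sum_le_sum fun i _ => h2 i).trans ?_
  rw [Finset.sum_add_distrib, Finset.sum_add_distrib, ← Finset.sum_div]
  simp only [Finset.sum_const, Finset.card_univ, Fintype.card_fin, nsmul_eq_mul, mul_one]
  have := div_le_div_of_nonneg_right h1 (show 0 ≤ 2 * μ by positivity)
  linarith

theorem second_moment_le {X χ T ε K : ℝ} (hX0 : 0 ≤ X) (hε : ε ≤ 1)
    (hK : 1 ≤ K) (hX : X ≤ ε * K) (hχ : T ^ 2 * χ ≤ K) :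
    9 * X ^ 2 + 4 * T ^ 2 * χ * X + 8 * X ≤ 21 * ε * K ^ 2 := by
  have hε0 : 0 ≤ ε := by
    by_contra h
    nlinarith
  have h1 : X ^ 2 ≤ ε * K ^ 2 := by
    have : X ≤ K := hX.trans (by nlinarith)
    nlinarith
  have h2 : T ^ 2 * χ * X ≤ ε * K ^ 2 := by nlinarith
  have h3 : X ≤ ε * K ^ 2 := by nlinarith [mul_nonneg hε0 (show 0 ≤ K by linarith)]
  nlinarith

/-- With `10 ^ 17 * d / θ` copies, thresholding `chiObservable` distinguishes small from large values
of the smoothed `χ²`-divergence of the average state. -/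
theorem exists_test_of_spectral {q : Fin d → ℝ} (hq : ∀ i, 0 ≤ q i) (hq1 : ∑ i, q i = 1)
    {σ U : Matrix (Fin d) (Fin d) ℂ} (hU : U * Uᴴ = 1)
    (hsp : σ = U * Matrix.diagonal (fun i => (q i : ℂ)) * Uᴴ) (hd : 0 < d) {θ : ℝ} (hθ : 0 < θ)
    (hT : (10 : ℝ) ^ 17 * (d / θ) ≤ T) :
    ∃ A : Test (Fin T → Fin d), ∀ ρ : Fin T → Matrix (Fin d) (Fin d) ℂ, (∀ t, IsState (ρ t)) →
      ∀ χ : ℝ, χ = weightedSq (fun i => q i + θ / (10 ^ 7 * d)) (Uᴴ * (avgState ρ - σ) * U) →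
        (χ ≤ 99 / 100 * θ → 99 / 100 ≤ A.acceptProb (productState ρ)) ∧
        (1005 / 1000 * θ ≤ χ → 99 / 100 ≤ A.rejectProb (productState ρ)) := by
  have hd0 : (0 : ℝ) < d := Nat.cast_pos.2 hd
  have hd1 : (1 : ℝ) ≤ d := Nat.one_le_cast.2 hd
  have hT0 : (0 : ℝ) < T := lt_of_lt_of_le (by positivity) hT
  have hTd : (10 : ℝ) ^ 17 * d ≤ T * θ := by
    rw [← mul_div_assoc, div_le_iff₀ hθ] at hT
    exact hT
  -- Small enough for dδ to be negligible against θ, yet only a constant factor below θ/d, which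
  -- keeps X of order Td while χ is of order θ.
  set δ : ℝ := θ / (10 ^ 7 * d) with hδdef
  have hδ : 0 < δ := by positivity
  set a : Fin d → ℝ := fun i => q i + δ with hadef
  have ha : ∀ i, 0 < a i := fun i => add_pos_of_nonneg_of_pos (hq i) hδ
  set σ' : Matrix (Fin d) (Fin d) ℂ := Matrix.diagonal fun i => (q i : ℂ) with hσ'
  have hσH : σ'.IsHermitian := by
    rw [hσ', Matrix.isHermitian_diagonal_iff]
    intro i
    simp [isSelfAdjoint_iff]
  have hU' : Uᴴ * U = 1 := mul_eq_one_comm.1 hU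
  -- The mean is close to T²χ/2, so the threshold corresponds to χ = θ.
  obtain ⟨B, hB⟩ := exists_test_of_isHermitian (isHermitian_chiObservable (T := T) a hσH)
    ((T : ℝ) ^ 2 * θ / 2)
  obtain ⟨A, hA⟩ := B.exists_conj (W := productState fun _ => U) (by
    rw [conjTranspose_productState, productState_mul]
    simp only [hU, productState_one])
  refine ⟨A, fun ρ hρ χ hχ => ?_⟩
  rw [(hA _).1, (hA _).2, conjTranspose_productState, productState_mul, productState_mul]
  set ρ' : Fin T → Matrix (Fin d) (Fin d) ℂ := fun t => Uᴴ * ρ t * U with hρ'def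
  have hρ' : ∀ t, IsState (ρ' t) := fun t => (hρ t).conj hU
  set Δ := Uᴴ * (avgState ρ - σ) * U with hΔ
  have hconj : Uᴴ * σ * U = σ' := by
    calc Uᴴ * σ * U = (Uᴴ * U) * σ' * (Uᴴ * U) := by rw [hsp]; simp only [mul_assoc]
      _ = σ' := by rw [hU', one_mul, mul_one]
  have hsum : ∑ t, (ρ' t - σ') = ((T : ℝ) : ℂ) • Δ := by
    have hTc : ((T : ℝ) : ℂ) ≠ 0 := by exact_mod_cast hT0.ne'
    rw [hΔ, mul_sub, sub_mul, hconj, avgState, smul_sub, Matrix.mul_smul, Matrix.smul_mul,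
      Complex.ofReal_natCast, smul_smul, mul_inv_cancel₀ (by simpa using hTc), one_smul,
      Finset.sum_sub_distrib, Finset.mul_sum, Finset.sum_mul]
    simp [Nat.cast_smul_eq_nsmul, ρ']
  have hχ0 : 0 ≤ χ := hχ ▸ weightedSq_nonneg ha _
  obtain ⟨m, hm1, hm2, hm3⟩ := chiObservable_moments hρ' ha hq
    (fun i => (le_add_iff_nonneg_right _).2 hδ.le) hq1 (χ := χ) hσ'
    (by rw [hsum, weightedSq_smul, hχ]) rfl
  set X := ∑ t, ∑ i, (ρ' t i i).re / a i with hXdef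
  have hX0 : 0 ≤ X := Finset.sum_nonneg fun t _ => Finset.sum_nonneg fun i _ =>
    div_nonneg (diag_re_nonneg (hρ' t).posSemidef i) (ha i).le
  have hXeq : X = T * ∑ i, (q i + (Δ i i).re) / (q i + δ) := by
    rw [hXdef, Finset.sum_comm, Finset.mul_sum]
    refine Finset.sum_congr rfl fun i _ => ?_
    have h1 := congrArg (fun M : Matrix (Fin d) (Fin d) ℂ => (M i i).re) hsum
    simp only [Matrix.sum_apply, Complex.re_sum, Matrix.sub_apply, Complex.sub_re,
      Finset.sum_sub_distrib, Matrix.smul_apply, smul_eq_mul, Complex.re_ofReal_mul, hσ',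
      Matrix.diagonal_apply_eq, Finset.sum_const, Finset.card_univ,
      Fintype.card_fin, nsmul_eq_mul] at h1
    rw [← Complex.ofReal_natCast, Complex.re_ofReal_mul, Complex.ofReal_re] at h1
    rw [← Finset.sum_div, ← mul_div_assoc]
    congr 1
    linarith
  have hXle : X ≤ T * (d * (1 + 5 * 10 ^ 6 + χ / (2 * θ))) := by
    rw [hXeq]
    refine mul_le_mul_of_nonneg_left ?_ hT0.le
    -- The choice μ = θ/d turns the last two terms into dχ/(2θ) and 5·10⁶d.
    refine (sum_diag_div_le hq hδ (show 0 < θ / d by positivity) Δ).trans (le_of_eq ?_)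
    rw [← hχ, hδdef]
    field_simp
    norm_num
    ring
  -- Used with κ = θ for acceptance and κ = χ for rejection, where χ has no upper bound and the
  -- variance must be compared with the signal T²χ itself.
  have hXK : ∀ κ : ℝ, θ ≤ κ → χ ≤ κ → X ≤ 10⁻¹ ^ 10 * (T ^ 2 * κ) := by
    intro κ h1 h2
    have h3 : X * θ ≤ T * d * (10 ^ 7 * κ) := by
      calc X * θ ≤ T * (d * (1 + 5 * 10 ^ 6 + χ / (2 * θ))) * θ :=
            mul_le_mul_of_nonneg_right hXle hθ.le
        _ = T * d * ((1 + 5 * 10 ^ 6) * θ + χ / 2) := by field_simp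
        _ ≤ _ := mul_le_mul_of_nonneg_left (by linarith) (by positivity)
    have h4 : T * d * (10 ^ 7 * κ) ≤ 10⁻¹ ^ 10 * (T ^ 2 * κ) * θ := by
      have := mul_le_mul_of_nonneg_left hTd (show 0 ≤ T * κ * 10⁻¹ ^ 10 by
        have : 0 ≤ κ := hθ.le.trans h1
        positivity)
      nlinarith
    exact le_of_mul_le_mul_right (h3.trans h4) hθ
  have hTK : ∀ κ : ℝ, θ ≤ κ → 1 ≤ T ^ 2 * κ ∧ T ≤ 10⁻¹ ^ 10 * (T ^ 2 * κ) := by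
    intro κ h1
    have hT1 : (1 : ℝ) ≤ T := by
      have : 0 < T := by exact_mod_cast hT0
      exact_mod_cast this
    have h2 : (10 : ℝ) ^ 17 ≤ T * θ := le_trans (by nlinarith) hTd
    have h3 : (T : ℝ) * θ ≤ T * κ := mul_le_mul_of_nonneg_left h1 hT0.le
    have h4 : (T : ℝ) * 10 ^ 17 ≤ T * (T * κ) := mul_le_mul_of_nonneg_left (h2.trans h3) hT0.le
    constructor <;> nlinarith
  have hB' := hB (productState ρ') (isState_productState hρ') m _ hm3
  constructor
  · intro hχθ
    obtain ⟨hK1, hK2⟩ := hTK θ le_rfl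
    have hle : T ^ 2 * χ ≤ 99 / 100 * (T ^ 2 * θ) := by
      have := mul_le_mul_of_nonneg_left hχθ (sq_nonneg (T : ℝ))
      linarith
    set K := (T : ℝ) ^ 2 * θ
    have hv := second_moment_le hX0 (by norm_num) hK1 (hXK θ le_rfl (by linarith))
      (show (T : ℝ) ^ 2 * χ ≤ K by linarith)
    -- The gap is exactly (1 − .99)/2 of K.
    refine hB'.1 (K / 200) (by linarith) (by linarith) (hv.trans ?_)
    norm_num
    nlinarith
  · intro hχθ
    have hθχ : θ ≤ χ := by linarith
    obtain ⟨hK1, hK2⟩ := hTK χ hθχ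
    have hle : 1005 / 1000 * (T ^ 2 * θ) ≤ T ^ 2 * χ := by
      have := mul_le_mul_of_nonneg_left hχθ (sq_nonneg (T : ℝ))
      linarith
    have hX' := hXK χ hθχ le_rfl
    set K := (T : ℝ) ^ 2 * χ
    have hv := second_moment_le hX0 (by norm_num) hK1 hX' (show (T : ℝ) ^ 2 * χ ≤ K from le_rfl)
    norm_num at hX' hK2
    -- Here T²θ/2 ≤ K/2.01, which leaves a gap above .0024K; the bias X + T is at most 2·10⁻¹⁰K.
    refine hB'.2 (K / 500) (by linarith) (by linarith) (hv.trans ?_)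
    norm_num
    nlinarith

/-- Tolerant identity testing of the average of `T ≥ 10 ^ 17 * d / θ` states. -/
theorem exists_test_avgState {σ : Matrix (Fin d) (Fin d) ℂ} (hσ : IsState σ) {θ : ℝ} (hθ : 0 < θ)
    (hT : (10 : ℝ) ^ 17 * (d / θ) ≤ T) :
    ∃ A : Test (Fin T → Fin d),
      ∀ ρ : Fin T → Matrix (Fin d) (Fin d) ℂ, (∀ t, IsState (ρ t)) →
        (buresChiSq (avgState ρ) hσ ≤ ENNReal.ofReal (99 / 100 * θ) →
          99 / 100 ≤ A.acceptProb (productState ρ)) ∧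
        (101 / 100 * θ < buresDist (avgState ρ) σ ^ 2 →
          99 / 100 ≤ A.rejectProb (productState ρ)) := by
  have hd : 0 < d := by
    rcases Nat.eq_zero_or_pos d with rfl | h
    · have := hσ.trace_eq_one
      simp [Matrix.trace] at this
    · exact h
  have hd0 : (0 : ℝ) < d := Nat.cast_pos.2 hd
  have hT0 : T ≠ 0 := by
    rintro rfl
    have : (0 : ℝ) < 10 ^ 17 * (d / θ) := by positivity
    simp only [Nat.cast_zero] at hT
    linarith
  have hH := hσ.posSemidef.isHermitian
  have hU : (hH.eigenvectorUnitary : Matrix (Fin d) (Fin d) ℂ) *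
      star (hH.eigenvectorUnitary : Matrix (Fin d) (Fin d) ℂ) = 1 :=
    Matrix.mem_unitaryGroup_iff.1 hH.eigenvectorUnitary.2
  have hsp := hH.spectral_theorem
  rw [Unitary.conjStarAlgAut_apply] at hsp
  have hq := hσ.posSemidef.eigenvalues_nonneg
  have hq1 : ∑ i, hH.eigenvalues i = 1 := by
    have h := hH.trace_eq_sum_eigenvalues
    rw [hσ.trace_eq_one] at h
    have h' := congrArg Complex.re h
    simpa using h'.symm
  obtain ⟨A, hA⟩ := exists_test_of_spectral hq hq1 hU hsp hd hθ hT
  have hδ : 0 < θ / (10 ^ 7 * d) := by positivity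
  refine ⟨A, fun ρ hρ => ?_⟩
  obtain ⟨h1, h2⟩ := hA ρ hρ _ rfl
  refine ⟨fun h => h1 ?_, fun h => h2 ?_⟩
  · have h3 := (ofReal_weightedSq_le_diagChiSq hq hδ _).trans h
    exact (ENNReal.ofReal_le_ofReal_iff (by positivity)).1 h3
  · have h3 := buresDist_sq_le_weightedSq (isState_avgState hT0 hρ) hσ hq hU hsp hδ
      (show (0 : ℝ) < 1 / 1000 by norm_num)
    have h4 : (Fintype.card (Fin d) : ℝ) * (θ / (10 ^ 7 * d)) = θ / 10 ^ 7 := by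
      rw [Fintype.card_fin]
      field_simp
    rw [h4] at h3
    linarith

end QuantumTesting

end

open QuantumTesting
theorem corollary6p2 :
    ∃ C : ℝ, 0 < C ∧
      ∀ (d : ℕ) (σ : Matrix (Fin d) (Fin d) ℂ) (hσ : IsState σ) (θ : ℝ), 0 < θ →
        ∀ T : ℕ, C * (d / θ) ≤ T →
          ∃ A : Test (Fin T → Fin d),
            ∀ ρ : Fin T → Matrix (Fin d) (Fin d) ℂ, (∀ t, IsState (ρ t)) →
              (buresChiSq (avgState ρ) hσ ≤ ENNReal.ofReal (99 / 100 * θ) →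
                99 / 100 ≤ A.acceptProb (productState ρ)) ∧
              (101 / 100 * θ < buresDist (avgState ρ) σ ^ 2 →
                99 / 100 ≤ A.rejectProb (productState ρ)) := by
  exact ⟨10 ^ 17, by norm_num, fun d σ hσ θ hθ T hT => exists_test_avgState hσ hθ hT⟩
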